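/- Let $X$ be a real locally convex topological vector space whose $\sigma$-algebra is generated by the continuous linear functionals and is standard Borel (if $X$ is a Hausdorff Souslin space, for instance a separable Fréchet space or $\mathcal D'(S^1)$, this $\sigma$-algebra is the Borel $\sigma$-algebra). A Gaussian measure on such a space is a (probability) measure whose image under every continuous linear functional is a, possibly degenerate, Gaussian measure on $\mathbb R$. A measure class is the set of all $\sigma$-finite positive measures that have the same null sets as a given one; $\mathcal C\otimes\mathcal C$ is the measure class on $X\times X$ containing $\mu\times\mu$ for $\mu\in\mathcal C$. The space $\mathcal H(\mathcal C)$ of half-densities consists of the families $\delta=(\delta_\mu)_{\mu\in\mathcal C}$, $\delta_\mu\in L^2(X,\mu;\mathbb R)$, with $\delta_\mu=\delta_\nu\,(d\nu/d\mu)^{1/2}$ for all $\mu,\nu\in\mathcal C$ (one writes $\delta=\delta_\mu(d\mu)^{1/2}$). A finite measure $\nu\in\mathcal C$ has the positive square root $\nu^{1/2}\in\mathcal H(\mathcal C)$ with $(\nu^{1/2})_\mu=(d\nu/d\mu)^{1/2}$. For a finite measure $\nu\in\mathcal C\otimes\mathcal C$, the half-density $\nu^{1/2}\in\mathcal H(\mathcal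 C\otimes\mathcal C)$ acts as the operator on $\mathcal H(\mathcal C)$ given by $(\nu^{1/2}\delta)_\mu(\phi)=\int(\nu^{1/2})_{\mu\times\mu}(\phi,\eta)\,\delta_\mu(\eta)\,d\mu(\eta)$, $\mu\in\mathcal C$. Let $\mathcal C$ be a measure class on $X$ that contains a Gaussian measure, and let $\nu_1,\nu_2$ be Gaussian measures on $X\times X$ that belong to $\mathcal C\otimes\mathcal C$. Then there is a finite measure $\nu_3\in\mathcal C\otimes\mathcal C$ such that $\nu_1^{1/2}\circ\nu_2^{1/2}=\nu_3^{1/2}$ as operators on $\mathcal H(\mathcal C)$ and $$\nu_3(\phi,\psi)=\Big(\int_\eta\nu_1(\phi,\eta)^{1/2}\,\nu_2(\eta,\psi)^{1/2}\Big)^2,$$ that is, for every $\mu\in\mathcal C$ and $(\mu\times\mu)$-almost every $(\phi,\psi)$, $$\frac{d\nu_3}{d(\mu\times\mu)}(\phi,\psi)=\Big(\int_X\Big(\frac{d\nu_1}{d(\mu\times\mu)}(\phi,\eta)\Big)^{1/2}\Big(\frac{d\nu_2}{d(\mu\times\mu)}(\eta,\psi)\Big)^{1/2}d\mu(\eta)\Big)^2;$$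 and every such $\nu_3$ is of the form $\nu_3=c\,G$ with a real constant $c>0$ and a Gaussian measure $G$ on $X\times X$. -/

import Mathlib

open MeasureTheory ProbabilityTheory
open scoped ENNReal NNReal

noncomputable section

namespace HalfDensities

/-- The `σ`-algebra of a topological vector space that is generated by its continuous linear
functionals. -/
abbrev cylinderSigmaAlgebra (X : Type*) [AddCommGroup X] [Module ℝ X] [TopologicalSpace X] :
    MeasurableSpace X :=
  ⨆ L : StrongDual ℝ X, MeasurableSpace.comap (fun x => L x) (borel ℝ)

/-- A measure class: all (positive) `σ`-finite measures having the same null sets as a given one. -/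
structure MeasureClass (X : Type*) [MeasurableSpace X] where
  carrier : Set (Measure X)
  exists_rep : ∃ μ : Measure X, SigmaFinite μ ∧
    carrier = {ν | SigmaFinite ν ∧ ν ≪ μ ∧ μ ≪ ν}

namespace MeasureClass

variable {X Y : Type*} [MeasurableSpace X] [MeasurableSpace Y]

instance : Membership (Measure X) (MeasureClass X) := ⟨fun 𝒞 μ => μ ∈ 𝒞.carrier⟩

/-- The measure class of a `σ`-finite measure. -/
def of (μ : Measure X) [SigmaFinite μ] : MeasureClass X :=
  ⟨{ν | SigmaFinite ν ∧ ν ≪ μ ∧ μ ≪ ν}, μ, inferInstance, rfl⟩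

theorem sigmaFinite {𝒞 : MeasureClass X} {μ : Measure X} (h : μ ∈ 𝒞) : SigmaFinite μ := by
  obtain ⟨ρ, -, hρ⟩ := 𝒞.exists_rep
  change μ ∈ 𝒞.carrier at h
  rw [hρ] at h
  exact h.1

theorem ac {𝒞 : MeasureClass X} {μ ν : Measure X} (hμ : μ ∈ 𝒞) (hν : ν ∈ 𝒞) : μ ≪ ν := by
  obtain ⟨ρ, -, hρ⟩ := 𝒞.exists_rep
  change μ ∈ 𝒞.carrier at hμ
  change ν ∈ 𝒞.carrier at hν
  rw [hρ] at hμ hν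
  exact hμ.2.1.trans hν.2.2

/-- The positive representatives of a measure class. -/
abbrev Rep (𝒞 : MeasureClass X) : Type _ := {μ : Measure X // μ ∈ 𝒞}

instance (𝒞 : MeasureClass X) (μ : 𝒞.Rep) : SigmaFinite (μ : Measure X) := sigmaFinite μ.2

/-- The measure class `𝒞 ⊗ 𝒟` on the product, generated by the products `μ × ν` with
`μ ∈ 𝒞` and `ν ∈ 𝒟`. -/
def tensor (𝒞 : MeasureClass X) (𝒟 : MeasureClass Y) : MeasureClass (X × Y) where
  carrier := {κ | SigmaFinite κ ∧ ∃ μ ∈ 𝒞, ∃ ν ∈ 𝒟, κ ≪ μ.prod ν ∧ μ.prod ν ≪ κ}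
  exists_rep := by
    obtain ⟨μ₀, h₀, e₀⟩ := 𝒞.exists_rep
    obtain ⟨ν₀, k₀, f₀⟩ := 𝒟.exists_rep
    have hμ₀ : μ₀ ∈ 𝒞 := by
      change μ₀ ∈ 𝒞.carrier
      rw [e₀]; exact ⟨h₀, .rfl, .rfl⟩
    have hν₀ : ν₀ ∈ 𝒟 := by
      change ν₀ ∈ 𝒟.carrier
      rw [f₀]; exact ⟨k₀, .rfl, .rfl⟩
    refine ⟨μ₀.prod ν₀, inferInstance, Set.ext fun κ => and_congr_right fun _ => ⟨?_, ?_⟩⟩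
    · rintro ⟨μ, hμ, ν, hν, h, h'⟩
      have := sigmaFinite hν
      exact ⟨h.trans ((ac hμ hμ₀).prod (ac hν hν₀)), ((ac hμ₀ hμ).prod (ac hν₀ hν)).trans h'⟩
    · rintro ⟨h, h'⟩
      exact ⟨μ₀, hμ₀, ν₀, hν₀, h, h'⟩

/-- The product of two representatives, as a representative of the tensor product. -/
def Rep.prod {𝒞 : MeasureClass X} {𝒟 : MeasureClass Y} (μ : 𝒞.Rep) (ν : 𝒟.Rep) :
    (𝒞.tensor 𝒟).Rep :=
  ⟨μ.1.prod ν.1, inferInstance, μ.1, μ.2, ν.1, ν.2, .rfl, .rfl⟩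

end MeasureClass

open MeasureClass

variable {X : Type*} [MeasurableSpace X]

/-- The positive square root `(dν/dμ)^{1/2}`. -/
def sqrtDeriv (ν μ : Measure X) (x : X) : ℝ := √(ν.rnDeriv μ x).toReal

theorem measurable_sqrtDeriv (ν μ : Measure X) : Measurable (sqrtDeriv ν μ) :=
  (Measure.measurable_rnDeriv ν μ).ennreal_toReal.sqrt

theorem sqrtDeriv_mul (ν ρ μ : Measure X) [SigmaFinite ν] [SigmaFinite ρ] [SigmaFinite μ]
    (h : ν ≪ ρ) :
    sqrtDeriv ν μ =ᵐ[μ] fun x => sqrtDeriv ν ρ x * sqrtDeriv ρ μ x := by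
  filter_upwards [Measure.rnDeriv_mul_rnDeriv (κ := μ) h] with x hx
  simp only [sqrtDeriv, ← hx, Pi.mul_apply, ENNReal.toReal_mul]
  exact Real.sqrt_mul ENNReal.toReal_nonneg _

theorem sqrtDeriv_prod (ν μ : Measure X) [SigmaFinite ν] [SigmaFinite μ] (h : ν ≪ μ) :
    sqrtDeriv (ν.prod ν) (μ.prod μ) =ᵐ[μ.prod μ]
      fun p => sqrtDeriv ν μ p.1 * sqrtDeriv ν μ p.2 := by
  have e : ν.prod ν =
      (μ.prod μ).withDensity (fun p => ν.rnDeriv μ p.1 * ν.rnDeriv μ p.2) := by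
    have : SigmaFinite (μ.withDensity (ν.rnDeriv μ)) := by
      rw [Measure.withDensity_rnDeriv_eq _ _ h]; infer_instance
    rw [← prod_withDensity (Measure.measurable_rnDeriv ν μ) (Measure.measurable_rnDeriv ν μ),
      Measure.withDensity_rnDeriv_eq _ _ h]
  have key : (ν.prod ν).rnDeriv (μ.prod μ) =ᵐ[μ.prod μ]
      fun p => ν.rnDeriv μ p.1 * ν.rnDeriv μ p.2 := by
    conv_lhs => rw [e]
    exact Measure.rnDeriv_withDensity _ (((Measure.measurable_rnDeriv ν μ).comp measurable_fst).mul
      ((Measure.measurable_rnDeriv ν μ).comp measurable_snd))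
  filter_upwards [key] with p hp
  simp only [sqrtDeriv, hp, ENNReal.toReal_mul]
  exact Real.sqrt_mul ENNReal.toReal_nonneg _

/-- The space `ℋ(𝒞)` of half-densities relative to the measure class `𝒞`. A half-density `δ` is
given by its coordinates `δ_μ ∈ L²(X, μ; ℝ)`, one for each representative `μ` of `𝒞`, where
`δ = δ_μ (dμ)^{1/2} = δ_ν (dν)^{1/2}`, that is, `δ_μ = δ_ν (dν/dμ)^{1/2}`. -/
def HalfDensity (𝒞 : MeasureClass X) : Submodule ℝ (∀ μ : 𝒞.Rep, Lp ℝ 2 (μ : Measure X)) where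
  carrier := {δ | ∀ μ ν : 𝒞.Rep, δ μ =ᵐ[μ.1] fun x => δ ν x * sqrtDeriv ν.1 μ.1 x}
  add_mem' := by
    intro a b ha hb μ ν
    filter_upwards [ha μ ν, hb μ ν, Lp.coeFn_add (a μ) (b μ),
      (ac μ.2 ν.2).ae_le (Lp.coeFn_add (a ν) (b ν))] with x h1 h2 h3 h4
    simp only [Pi.add_apply] at h3 h4 ⊢
    rw [h3, h4, h1, h2]; ring
  zero_mem' := by
    intro μ ν
    filter_upwards [Lp.coeFn_zero ℝ 2 μ.1, (ac μ.2 ν.2).ae_le (Lp.coeFn_zero ℝ 2 ν.1)] with x h1 h2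
    simp only [Pi.zero_apply] at h1 h2 ⊢
    rw [h1, h2, zero_mul]
  smul_mem' := by
    intro c a ha μ ν
    filter_upwards [ha μ ν, Lp.coeFn_smul c (a μ),
      (ac μ.2 ν.2).ae_le (Lp.coeFn_smul c (a ν))] with x h1 h3 h4
    simp only [Pi.smul_apply, smul_eq_mul] at h3 h4 ⊢
    rw [h3, h4, h1]; ring

/-- The coordinate of a half-density with respect to a representative. -/
def coord {𝒞 : MeasureClass X} (δ : HalfDensity 𝒞) (μ : 𝒞.Rep) :
    Lp ℝ 2 (μ : Measure X) :=
  δ.1 μ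

theorem memLp_sqrtDeriv (ν μ : Measure X) [IsFiniteMeasure ν] : MemLp (sqrtDeriv ν μ) 2 μ := by
  rw [memLp_two_iff_integrable_sq (measurable_sqrtDeriv ν μ).aestronglyMeasurable]
  simp only [sqrtDeriv, Real.sq_sqrt ENNReal.toReal_nonneg]
  exact Measure.integrable_toReal_rnDeriv

/-- The positive square root `ν^{1/2}` in `ℋ(𝒞)` of a finite measure `ν` in `𝒞`. -/
def sqrtMeasure {𝒞 : MeasureClass X} (ν : Measure X) [IsFiniteMeasure ν] (hν : ν ∈ 𝒞) :
    HalfDensity 𝒞 :=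
  ⟨fun μ => (memLp_sqrtDeriv ν μ.1).toLp, fun μ ρ => by
    filter_upwards [(memLp_sqrtDeriv ν μ.1).coeFn_toLp,
      (ac μ.2 ρ.2).ae_le (memLp_sqrtDeriv ν ρ.1).coeFn_toLp,
      sqrtDeriv_mul ν ρ.1 μ.1 (ac hν ρ.2)] with x h1 h2 h3
    rw [h1, h2, h3]⟩

/-- Almost every section of an `L²` kernel is in `L²`. -/
theorem ae_memLp_section {μ : Measure X} [SigmaFinite μ] {K : X × X → ℝ}
    (hK : MemLp K 2 (μ.prod μ)) : ∀ᵐ x ∂μ, MemLp (fun y => K (x, y)) 2 μ := by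
  have h := (memLp_two_iff_integrable_sq hK.1).1 hK
  filter_upwards [h.prod_right_ae, hK.1.prodMk_left] with x hx hm
  exact (memLp_two_iff_integrable_sq hm).2 hx

/-- An `L²` kernel maps `L²` to `L²`. -/
theorem memLp_kernel {μ : Measure X} [SigmaFinite μ] {K : X × X → ℝ}
    (hK : MemLp K 2 (μ.prod μ)) {f : X → ℝ} (hf : MemLp f 2 μ) :
    MemLp (fun x => ∫ y, K (x, y) * f y ∂μ) 2 μ := by
  have hm : AEStronglyMeasurable (fun x => ∫ y, K (x, y) * f y ∂μ) μ :=
    AEStronglyMeasurable.integral_prod_right' (f := fun p : X × X => K p * f p.2)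
      (hK.1.mul hf.1.comp_snd)
  rw [memLp_two_iff_integrable_sq hm]
  have hK2 := (memLp_two_iff_integrable_sq hK.1).1 hK
  have hI : Integrable (fun x => (∫ y, K (x, y) ^ 2 ∂μ) * ∫ y, f y ^ 2 ∂μ) μ :=
    hK2.integral_prod_left.mul_const _
  refine hI.mono (hm.pow 2) ?_
  filter_upwards [ae_memLp_section hK] with x hx
  rw [Real.norm_of_nonneg (sq_nonneg _), Real.norm_of_nonneg (by positivity)]
  have hxs := (memLp_two_iff_integrable_sq hx.1).1 hx
  have hfs := (memLp_two_iff_integrable_sq hf.1).1 hf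
  have hxf : Integrable (fun y => K (x, y) * f y) μ := hx.integrable_mul hf
  have key : ∀ t : ℝ, 0 ≤ (∫ y, f y ^ 2 ∂μ) * (t * t) + (2 * ∫ y, K (x, y) * f y ∂μ) * t
      + ∫ y, K (x, y) ^ 2 ∂μ := by
    intro t
    have h1 : 0 ≤ ∫ y, (K (x, y) + t * f y) ^ 2 ∂μ := integral_nonneg fun y => sq_nonneg _
    have h2 : ∫ y, (K (x, y) + t * f y) ^ 2 ∂μ =
        ∫ y, (K (x, y) ^ 2 + ((2 * t) * (K (x, y) * f y) + t ^ 2 * f y ^ 2)) ∂μ := by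
      congr 1; ext y; ring
    have h3 : Integrable (fun y => (2 * t) * (K (x, y) * f y)) μ := hxf.const_mul _
    have h4 : Integrable (fun y => t ^ 2 * f y ^ 2) μ := hfs.const_mul _
    have h5 : Integrable (fun y => (2 * t) * (K (x, y) * f y) + t ^ 2 * f y ^ 2) μ := h3.add h4
    rw [h2, integral_add hxs h5, integral_add h3 h4, integral_const_mul,
      integral_const_mul] at h1
    linarith
  have := discrim_le_zero key
  rw [discrim] at this
  nlinarith

/-- The coordinates of `K δ`, see `kernelOp`. -/
def kernelCoord {𝒞 : MeasureClass X} (K : HalfDensity (𝒞.tensor 𝒞)) (δ : HalfDensity 𝒞)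
    (μ : 𝒞.Rep) : Lp ℝ 2 (μ : Measure X) :=
  MemLp.toLp (fun x => ∫ y, coord K (μ.prod μ) (x, y) * coord δ μ y ∂μ.1)
    (memLp_kernel (Lp.memLp (coord K (μ.prod μ))) (Lp.memLp (coord δ μ)))

theorem coeFn_kernelCoord {𝒞 : MeasureClass X} (K : HalfDensity (𝒞.tensor 𝒞))
    (δ : HalfDensity 𝒞) (μ : 𝒞.Rep) :
    kernelCoord K δ μ =ᵐ[μ.1] fun x => ∫ y, coord K (μ.prod μ) (x, y) * coord δ μ y ∂μ.1 :=
  MemLp.coeFn_toLp _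

theorem kernelCoord_mem {𝒞 : MeasureClass X} (K : HalfDensity (𝒞.tensor 𝒞))
    (δ : HalfDensity 𝒞) : kernelCoord K δ ∈ HalfDensity 𝒞 := by
  intro μ ν
  have hμν := ac μ.2 ν.2
  have hνμ := ac ν.2 μ.2
  filter_upwards [coeFn_kernelCoord K δ μ, hμν.ae_le (coeFn_kernelCoord K δ ν),
    Measure.ae_ae_of_ae_prod (K.2 (μ.prod μ) (ν.prod ν)),
    Measure.ae_ae_of_ae_prod (sqrtDeriv_prod ν.1 μ.1 hνμ)] with x h1 h2 h3 h4
  rw [h1, h2, ← integral_rnDeriv_smul hνμ, ← integral_mul_const]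
  apply integral_congr_ae
  filter_upwards [h3, h4, δ.2 μ ν] with y h3 h4 h5
  change coord K (μ.prod μ) (x, y) = coord K (ν.prod ν) (x, y) *
    sqrtDeriv (ν.1.prod ν.1) (μ.1.prod μ.1) (x, y) at h3
  change coord δ μ y = coord δ ν y * _ at h5
  have h6 : sqrtDeriv ν.1 μ.1 y * sqrtDeriv ν.1 μ.1 y = (ν.1.rnDeriv μ.1 y).toReal :=
    Real.mul_self_sqrt ENNReal.toReal_nonneg
  rw [h3, h4, h5, smul_eq_mul, ← h6]
  ring

/-- The operator on `ℋ(𝒞)` given by a half-density `K` on `X × X` of class `𝒞 ⊗ 𝒞`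
(an element of `ℋ(𝒞) ⊗ ℋ(𝒞)`, i.e. the kernel of a Hilbert–Schmidt operator): in the coordinates of
each representative `μ` it is `(K δ)_μ (x) = ∫ K_{μ × μ} (x, y) δ_μ (y) dμ(y)`. -/
def kernelOp {𝒞 : MeasureClass X} (K : HalfDensity (𝒞.tensor 𝒞)) :
    HalfDensity 𝒞 →ₗ[ℝ] HalfDensity 𝒞 where
  toFun δ := ⟨kernelCoord K δ, kernelCoord_mem K δ⟩
  map_add' a b := by
    refine Subtype.ext (funext fun μ => Lp.ext ?_)
    change kernelCoord K (a + b) μ =ᵐ[μ.1] (kernelCoord K a μ + kernelCoord K b μ : Lp ℝ 2 μ.1)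
    filter_upwards [coeFn_kernelCoord K (a + b) μ, coeFn_kernelCoord K a μ,
      coeFn_kernelCoord K b μ, Lp.coeFn_add (kernelCoord K a μ) (kernelCoord K b μ),
      ae_memLp_section (μ := μ.1) (Lp.memLp (coord K (μ.prod μ)))] with x h0 h1 h2 h3 h4
    have ia : Integrable (fun y => coord K (μ.prod μ) (x, y) * coord a μ y) μ.1 :=
      h4.integrable_mul (Lp.memLp (coord a μ))
    have ib : Integrable (fun y => coord K (μ.prod μ) (x, y) * coord b μ y) μ.1 :=
      h4.integrable_mul (Lp.memLp (coord b μ))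
    rw [h0, h3, Pi.add_apply, h1, h2, ← integral_add ia ib]
    apply integral_congr_ae
    filter_upwards [Lp.coeFn_add (coord a μ) (coord b μ)] with y hy
    change _ * (coord a μ + coord b μ : Lp ℝ 2 μ.1) y = _
    rw [hy, Pi.add_apply, mul_add]
  map_smul' c a := by
    refine Subtype.ext (funext fun μ => Lp.ext ?_)
    change kernelCoord K (c • a) μ =ᵐ[μ.1] (c • kernelCoord K a μ : Lp ℝ 2 μ.1)
    filter_upwards [coeFn_kernelCoord K (c • a) μ, coeFn_kernelCoord K a μ,
      Lp.coeFn_smul c (kernelCoord K a μ)] with x h0 h1 h3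
    rw [h0, h3, Pi.smul_apply, h1, smul_eq_mul, ← integral_const_mul]
    apply integral_congr_ae
    filter_upwards [Lp.coeFn_smul c (coord a μ)] with y hy
    change _ * (c • coord a μ : Lp ℝ 2 μ.1) y = _
    rw [hy, Pi.smul_apply, smul_eq_mul]
    ring

/-- `ν₃` is the half-density composition of the finite measures `ν₁`, `ν₂` in `𝒞 ⊗ 𝒞`: it is a finite
measure in `𝒞 ⊗ 𝒞` such that `ν₁^{1/2} ∘ ν₂^{1/2} = ν₃^{1/2}` as operators on `ℋ(𝒞)`, and
`ν₃(φ, ψ) = (∫_η ν₁(φ, η)^{1/2} ν₂(η, ψ)^{1/2})²`, which is read in the coordinates of each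
representative `μ` of `𝒞`. -/
def IsComposition (𝒞 : MeasureClass X) (ν₁ ν₂ : Measure (X × X)) [IsFiniteMeasure ν₁]
    [IsFiniteMeasure ν₂] (h₁ : ν₁ ∈ 𝒞.tensor 𝒞) (h₂ : ν₂ ∈ 𝒞.tensor 𝒞)
    (ν₃ : Measure (X × X)) : Prop :=
  ∃ (_ : IsFiniteMeasure ν₃) (h₃ : ν₃ ∈ 𝒞.tensor 𝒞),
    kernelOp (sqrtMeasure ν₁ h₁) ∘ₗ kernelOp (sqrtMeasure ν₂ h₂) = kernelOp (sqrtMeasure ν₃ h₃) ∧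
    ∀ μ : 𝒞.Rep, ∀ᵐ p ∂(μ.1.prod μ.1),
      (ν₃.rnDeriv (μ.1.prod μ.1) p).toReal =
        (∫ η, coord (sqrtMeasure ν₁ h₁) (μ.prod μ) (p.1, η) *
          coord (sqrtMeasure ν₂ h₂) (μ.prod μ) (η, p.2) ∂μ.1) ^ 2

end HalfDensities

end

/-! By Bernstein's characterization, a probability measure `G` on a space with its cylinder
σ-algebra is Gaussian exactly when the rotation `(x, y) ↦ (x + y, x - y)` turns `G × G` into a
product measure (`map_addSub_of_isGaussian`, `isGaussian_of_map_addSub`). This property survives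
half-density composition, so no covariance operators or explicit Gaussian densities are needed.

Let `γ ∈ 𝒞` be Gaussian, with `γ × γ` rotating to `α × β`. If `ν = f · (γ × γ)` is Gaussian, then
`f(x, z) f(x', z') = p(x + x', z + z') q(x - x', z - z')` almost everywhere, and likewise for square
roots. The product of two copies of the composed kernel is an integral over `(y, y')` against `γ ×
γ`; the substitution `(u, v) = (y + y', y - y')` splits it into an integral over `α` times one over
`β` (`factorization_comp`). Hence the composed density factors in the same way, and the normalized
composition is Gaussian.

Existence is Hilbert–Schmidt calculus: Cauchy–Schwarz gives finite mass, positivity of the integrand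
gives the right null sets, the chain rule for densities removes the dependence on the reference
measure, and Fubini identifies the composed operator. -/

namespace HalfDensities

/-! ### Functional equations on the line and Bernstein's theorem -/

/-- A continuous solution of the parallelogram identity on the line is a quadratic monomial. -/
theorem eq_mul_sq_of_parallelogram {g : ℝ → ℝ} (hg : Continuous g)
    (h : ∀ s t, g (s + t) + g (s - t) = 2 * g s + 2 * g t) (t : ℝ) : g t = g 1 * t ^ 2 := by
  have h0 : g 0 = 0 := by have := h 0 0; simp at this; linarith
  have heven (t : ℝ) : g (-t) = g t := by
    have := h 0 t; simp [h0] at this; linarith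
  have hnat (n : ℕ) (t : ℝ) : g (n * t) = n ^ 2 * g t := by
    -- The identity is a second-order recursion in `n`, so two consecutive values are carried.
    suffices H : g (n * t) = n ^ 2 * g t ∧ g ((n + 1 : ℕ) * t) = (n + 1 : ℕ) ^ 2 * g t from H.1
    induction n with
    | zero => simp [h0]
    | succ n ih =>
      refine ⟨ih.2, ?_⟩
      have := h ((n + 1 : ℕ) * t) t
      have e1 : ((n + 1 : ℕ) : ℝ) * t + t = ((n + 1 + 1 : ℕ) : ℝ) * t := by push_cast; ring
      have e2 : ((n + 1 : ℕ) : ℝ) * t - t = (n : ℝ) * t := by push_cast; ring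
      rw [e1, e2, ih.1, ih.2] at this
      push_cast at this ⊢
      linarith
  have hint (n : ℤ) (t : ℝ) : g (n * t) = n ^ 2 * g t := by
    obtain ⟨m, rfl | rfl⟩ := n.eq_nat_or_neg
    · exact_mod_cast hnat m t
    · push_cast
      rw [neg_mul, heven, hnat]; ring
  refine congrFun (Continuous.ext_on Rat.denseRange_cast (g := fun t => g 1 * t ^ 2) hg
    (by fun_prop) ?_) t
  rintro _ ⟨q, rfl⟩
  have hd : (q.den : ℝ) ≠ 0 := by exact_mod_cast q.den_nz
  have e : (q.den : ℝ) * (q : ℝ) = (q.num : ℝ) * 1 := by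
    rw [mul_one]; exact_mod_cast (mul_comm _ _).trans q.mul_den_eq_num
  have h1 := hnat q.den q
  rw [e, hint] at h1
  have e2 : (q : ℝ) = q.num / q.den := by rw [eq_div_iff hd]; linarith
  simp only
  rw [e2] at h1 ⊢
  field_simp at h1 ⊢
  linarith

/-- A continuous unitary character of the line is an exponential. -/
theorem exists_eq_exp_of_map_add {χ : ℝ → ℂ} (hχ : Continuous χ)
    (hadd : ∀ s t, χ (s + t) = χ s * χ t) (hnorm : ∀ t, ‖χ t‖ = 1) :
    ∃ m : ℝ, ∀ t, χ t = Complex.exp (t * m * Complex.I) := by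
  have h0 : χ 0 = 1 := by
    have h := hadd 0 0
    have hne : χ 0 ≠ 0 := fun h => by simpa [h] using hnorm 0
    rw [add_zero] at h
    exact (mul_right_cancel₀ hne (by rw [one_mul]; exact h)).symm
  set F : ℝ → ℂ := fun x => ∫ s in (0 : ℝ)..x, χ s with hF
  have hFd (x : ℝ) : HasDerivAt F (χ x) x :=
    intervalIntegral.integral_hasDerivAt_right (hχ.intervalIntegrable _ _)
      (hχ.stronglyMeasurableAtFilter _ _) hχ.continuousAt
  obtain ⟨a, ha⟩ : ∃ a, F a ≠ 0 := by
    by_contra! h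
    have h1 := hFd 0
    have : F = fun _ => 0 := funext h
    rw [this] at h1
    have := h1.unique (hasDerivAt_const _ _)
    rw [h0] at this
    exact one_ne_zero this
  -- Integrating `χ (t + s) = χ t * χ s` over `s ∈ [0, a]` expresses `χ` through its primitive, so
  -- continuity upgrades to differentiability.
  have hmul (t : ℝ) : χ t = (F (t + a) - F t) / F a := by
    rw [eq_div_iff ha, hF]
    simp only
    rw [← intervalIntegral.integral_const_mul, intervalIntegral.integral_interval_sub_left
      (hχ.intervalIntegrable _ _) (hχ.intervalIntegrable _ _)]
    simp_rw [← hadd]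
    rw [intervalIntegral.integral_comp_add_left]
    simp
  have hd (t : ℝ) : DifferentiableAt ℝ χ t := by
    have h1 : DifferentiableAt ℝ (fun t => F (t + a)) t :=
      ((hFd (t + a)).comp_add_const t a).differentiableAt
    have : χ = fun t => (F (t + a) - F t) / F a := funext hmul
    rw [this]
    exact (h1.sub (hFd t).differentiableAt).div_const _
  set c := deriv χ 0
  have hderiv (t : ℝ) : HasDerivAt χ (χ t * c) t := by
    have h1 : HasDerivAt (fun s => χ (t + s)) (χ t * c) 0 := by
      simp_rw [hadd]
      exact (hd 0).hasDerivAt.const_mul _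
    have h2 : HasDerivAt (fun s => χ (t + s)) (deriv χ t) 0 := by
      have := (hd (t + 0)).hasDerivAt.comp_const_add t 0
      simpa using this
    rw [h1.unique h2]
    exact (hd t).hasDerivAt
  have hconst (t : ℝ) : χ t * Complex.exp (-(t * c)) = 1 := by
    have hD (t : ℝ) : HasDerivAt (fun t : ℝ => χ t * Complex.exp (-(t * c))) 0 t := by
      have h2 : HasDerivAt (fun t : ℝ => -((t : ℂ) * c)) (-(1 * c)) t :=
        (Complex.ofRealCLM.hasDerivAt.mul_const c).neg
      have := (hderiv t).mul h2.cexp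
      convert! this using 1
      ring
    have := is_const_of_deriv_eq_zero (fun t => (hD t).differentiableAt) (fun t => (hD t).deriv) t 0
    simpa [h0] using this
  have hexp (t : ℝ) : χ t = Complex.exp (t * c) := by
    rw [eq_comm, ← mul_one (Complex.exp _), ← hconst t, mul_left_comm, ← Complex.exp_add]
    simp
  have hre : c.re = 0 := by
    have := hnorm 1
    rw [hexp, Complex.norm_exp] at this
    simpa using this
  refine ⟨c.im, fun t => ?_⟩
  rw [hexp, mul_assoc]
  congr 2
  apply Complex.ext <;> simp [hre]

/-- **Bernstein's characterization of Gaussian laws**, in terms of characteristic functions. -/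
theorem exists_eq_gaussianReal_of_charFun (p : Measure ℝ) [IsProbabilityMeasure p]
    (h : ∀ s t, charFun p (s + t) * charFun p (s - t) =
      charFun p s ^ 2 * (charFun p t * charFun p (-t))) :
    ∃ (m : ℝ) (v : ℝ≥0), p = gaussianReal m v := by
  set φ := charFun p with hφ
  have hc : Continuous φ := continuous_charFun
  have h0 : φ 0 = 1 := by simp [hφ]
  have hneg (t : ℝ) : ‖φ (-t)‖ = ‖φ t‖ := by rw [hφ, charFun_neg]; simp
  have hdouble (s : ℝ) : φ (2 * s) = φ s ^ 2 * (φ s * φ (-s)) := by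
    have := h s s
    rwa [sub_self, h0, mul_one, ← two_mul] at this
  -- Since `‖φ (2 * s)‖ = ‖φ s‖ ^ 4`, a zero at `t` would produce zeros at all `t / 2 ^ n`,
  -- contradicting `φ 0 = 1` by continuity.
  have hne (t : ℝ) : φ t ≠ 0 := by
    intro ht
    have hn (n : ℕ) : φ (t * (1 / 2) ^ n) = 0 := by
      induction n with
      | zero => simpa using ht
      | succ n ih =>
        have h1 := hdouble (t * (1 / 2) ^ (n + 1))
        rw [show 2 * (t * (1 / 2 : ℝ) ^ (n + 1)) = t * (1 / 2) ^ n by ring, ih] at h1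
        have h2 : ‖φ (t * (1 / 2) ^ (n + 1))‖ ^ 4 = 0 := by
          have := congrArg norm h1
          rw [norm_mul, norm_pow, norm_mul, hneg, norm_zero] at this
          rw [this]; ring
        exact norm_eq_zero.1 (pow_eq_zero_iff (by norm_num) |>.1 h2)
    have hl : Filter.Tendsto (fun n : ℕ => t * (1 / 2 : ℝ) ^ n) Filter.atTop (nhds 0) := by
      simpa using (tendsto_pow_atTop_nhds_zero_of_lt_one (r := (1 / 2 : ℝ)) (by norm_num)
        (by norm_num)).const_mul t
    have hl2 := (hc.tendsto 0).comp hl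
    have : Filter.Tendsto (φ ∘ fun n : ℕ => t * (1 / 2 : ℝ) ^ n) Filter.atTop (nhds 0) := by
      refine tendsto_const_nhds.congr fun n => (hn n).symm
    have := tendsto_nhds_unique hl2 this
    rw [h0] at this
    exact one_ne_zero this
  have hnne (t : ℝ) : ‖φ t‖ ≠ 0 := norm_ne_zero_iff.2 (hne t)
  set g : ℝ → ℝ := fun t => Real.log ‖φ t‖ with hg
  have hgc : Continuous g := hc.norm.log hnne
  have hgq := eq_mul_sq_of_parallelogram hgc fun s t => by
    have := congrArg (fun z => Real.log ‖z‖) (h s t)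
    simp only [norm_mul, norm_pow, hneg] at this
    rw [Real.log_mul (hnne _) (hnne _), Real.log_mul (pow_ne_zero _ (hnne _))
      (mul_ne_zero (hnne _) (hnne _)), Real.log_pow, Real.log_mul (hnne _) (hnne _)] at this
    simp only [hg]
    push_cast at this
    linarith
  have hg1 : g 1 ≤ 0 := Real.log_nonpos (norm_nonneg _) (norm_charFun_le_one 1)
  have hχnorm (t : ℝ) : ‖φ t / ‖φ t‖‖ = 1 := by
    rw [norm_div, Complex.norm_real, norm_norm, div_self (hnne t)]
  have hneC (t : ℝ) : (‖φ t‖ : ℂ) ≠ 0 := by exact_mod_cast hnne t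
  -- The factor `φ t * φ (-t) = ‖φ t‖ ^ 2` has trivial phase, so the phases satisfy a multiplicative
  -- Jensen equation; with value 1 at 0 this makes them a character.
  have hchar (s t : ℝ) : φ (s + t) / ‖φ (s + t)‖ * (φ (s - t) / ‖φ (s - t)‖) =
      (φ s / ‖φ s‖) ^ 2 := by
    have h1 : (‖φ (s + t)‖ : ℂ) * ‖φ (s - t)‖ = ‖φ s‖ ^ 2 * (‖φ t‖ * ‖φ t‖) := by
      have := congrArg norm (h s t)
      simp only [norm_mul, norm_pow, hneg] at this
      exact_mod_cast this
    have h2 : φ t * φ (-t) = ‖φ t‖ * ‖φ t‖ := by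
      rw [hφ, charFun_neg, Complex.mul_conj, Complex.normSq_eq_norm_sq]; push_cast; ring
    rw [div_mul_div_comm, h, h1, h2, div_pow, mul_div_mul_right _ _ (mul_ne_zero (hneC t) (hneC t))]
  obtain ⟨m, hm⟩ := exists_eq_exp_of_map_add (χ := fun t => φ t / ‖φ t‖)
    (hc.div (Complex.continuous_ofReal.comp hc.norm) hneC) (fun s t => by
      have h1 := hchar ((s + t) / 2) ((s + t) / 2)
      have h2 := hchar ((s + t) / 2) ((s - t) / 2)
      rw [← h1] at h2
      simp only [add_halves, sub_self, h0] at h2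
      rw [show (s + t) / 2 + (s - t) / 2 = s by ring, show (s + t) / 2 - (s - t) / 2 = t by ring]
        at h2
      rw [h2]; simp) hχnorm
  -- The variance comes from matching `exp (g 1 * t ^ 2)` with `exp (-v * t ^ 2 / 2)`.
  refine ⟨m, (-2 * g 1).toNNReal, Measure.ext_of_charFun (funext fun t => ?_)⟩
  rw [charFun_gaussianReal, Real.coe_toNNReal _ (by linarith)]
  have h1 : φ t = ‖φ t‖ * (φ t / ‖φ t‖) := (mul_div_cancel₀ _ (hneC t)).symm
  have h2 : ‖φ t‖ = Real.exp (g 1 * t ^ 2) := by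
    rw [← hgq, Real.exp_log (norm_pos_iff.2 (hne t))]
  have h3 := hm t
  rw [← hφ, h1, h3, h2, Complex.ofReal_exp, ← Complex.exp_add]
  congr 1
  push_cast
  ring

/-! ### The rotation of a product -/

section Rotation

variable {E : Type*} [AddCommGroup E] [Module ℝ E] [MeasurableSpace E] [MeasurableAdd₂ E]
  [MeasurableSub₂ E] [MeasurableConstSMul ℝ E]

/-- The (unnormalized) rotation `(x, y) ↦ (x + y, x - y)` of `E × E`. -/
noncomputable def addSub (E : Type*) [AddCommGroup E] [Module ℝ E] [MeasurableSpace E]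
    [MeasurableAdd₂ E] [MeasurableSub₂ E] [MeasurableConstSMul ℝ E] : E × E ≃ᵐ E × E where
  toFun p := (p.1 + p.2, p.1 - p.2)
  invFun p := ((1 / 2 : ℝ) • (p.1 + p.2), (1 / 2 : ℝ) • (p.1 - p.2))
  left_inv p := by ext <;> simp only <;> module
  right_inv p := by ext <;> simp only <;> module
  measurable_toFun := by
    change Measurable fun p : E × E => (p.1 + p.2, p.1 - p.2)
    fun_prop
  measurable_invFun := by
    change Measurable fun p : E × E => ((1 / 2 : ℝ) • (p.1 + p.2), (1 / 2 : ℝ) • (p.1 - p.2))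
    fun_prop

@[simp]
theorem addSub_apply (p : E × E) : addSub E p = (p.1 + p.2, p.1 - p.2) := rfl

end Rotation

/-! ### Cylinder σ-algebras and characteristic functionals -/

section Cylinder

variable {E F : Type*} [AddCommGroup E] [Module ℝ E] [TopologicalSpace E]
  [AddCommGroup F] [Module ℝ F] [TopologicalSpace F]

theorem measurable_dual [mE : MeasurableSpace E] (hE : mE = cylinderSigmaAlgebra E)
    (L : StrongDual ℝ E) : Measurable L := by
  have : MeasurableSpace.comap (fun x => L x) (borel ℝ) ≤ mE := by
    rw [hE]
    exact le_iSup (fun L : StrongDual ℝ E => MeasurableSpace.comap (fun x => L x) (borel ℝ)) L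
  rw [measurable_iff_comap_le, BorelSpace.measurable_eq (α := ℝ)]
  exact this

theorem measurable_of_dual [mE : MeasurableSpace E] (hE : mE = cylinderSigmaAlgebra E)
    {α : Type*} [MeasurableSpace α] {f : α → E}
    (hf : ∀ L : StrongDual ℝ E, Measurable fun a => L (f a)) : Measurable f := by
  rw [measurable_iff_comap_le, hE, MeasurableSpace.comap_iSup]
  refine iSup_le fun L => ?_
  rw [MeasurableSpace.comap_comp, ← BorelSpace.measurable_eq (α := ℝ)]
  exact (hf L).comap_le

theorem measurableAdd₂_of_cylinder [mE : MeasurableSpace E] (hE : mE = cylinderSigmaAlgebra E) :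
    MeasurableAdd₂ E :=
  ⟨measurable_of_dual hE fun L => by
    simp only [map_add]
    exact ((measurable_dual hE L).comp measurable_fst).add
      ((measurable_dual hE L).comp measurable_snd)⟩

theorem measurableSub₂_of_cylinder [mE : MeasurableSpace E] (hE : mE = cylinderSigmaAlgebra E) :
    MeasurableSub₂ E :=
  ⟨measurable_of_dual hE fun L => by
    simp only [map_sub]
    exact ((measurable_dual hE L).comp measurable_fst).sub
      ((measurable_dual hE L).comp measurable_snd)⟩

theorem measurableConstSMul_of_cylinder [mE : MeasurableSpace E]
    (hE : mE = cylinderSigmaAlgebra E) : MeasurableConstSMul ℝ E :=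
  ⟨fun c => measurable_of_dual hE fun L => by
    simp only [map_smul]
    exact (measurable_dual hE L).const_smul c⟩

/-- The product of cylinder `σ`-algebras is the cylinder `σ`-algebra of the product. -/
theorem prod_eq_cylinderSigmaAlgebra [mE : MeasurableSpace E] [mF : MeasurableSpace F]
    (hE : mE = cylinderSigmaAlgebra E) (hF : mF = cylinderSigmaAlgebra F) :
    (Prod.instMeasurableSpace : MeasurableSpace (E × F)) = cylinderSigmaAlgebra (E × F) := by
  apply le_antisymm
  · refine sup_le ?_ ?_
    · rw [hE, MeasurableSpace.comap_iSup]
      refine iSup_le fun L => ?_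
      rw [MeasurableSpace.comap_comp]
      exact le_iSup (fun L : StrongDual ℝ (E × F) => MeasurableSpace.comap (fun x => L x) (borel ℝ))
        (L.comp (.fst ℝ E F))
    · rw [hF, MeasurableSpace.comap_iSup]
      refine iSup_le fun L => ?_
      rw [MeasurableSpace.comap_comp]
      exact le_iSup (fun L : StrongDual ℝ (E × F) => MeasurableSpace.comap (fun x => L x) (borel ℝ))
        (L.comp (.snd ℝ E F))
  · refine iSup_le fun L => ?_
    rw [← BorelSpace.measurable_eq (α := ℝ)]
    have h : (fun x => L x) = fun p : E × F =>
        L.comp (.inl ℝ E F) p.1 + L.comp (.inr ℝ E F) p.2 := by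
      ext p; simp [← map_add]
    rw [h]
    exact (((measurable_dual hE _).comp measurable_fst).add
      ((measurable_dual hF _).comp measurable_snd)).comap_le

theorem charFun_map_dual [MeasurableSpace E] (μ : Measure E) {L : StrongDual ℝ E}
    (hL : Measurable L) (t : ℝ) :
    charFun (μ.map L) t = ∫ x, Complex.exp (t * L x * Complex.I) ∂μ := by
  rw [charFun_apply_real, integral_map hL.aemeasurable (by fun_prop)]

/-- A finite measure on the cylinder `σ`-algebra is determined by its characteristic functional. -/
theorem ext_of_integral_exp_dual [mE : MeasurableSpace E] (hE : mE = cylinderSigmaAlgebra E)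
    {μ ν : Measure E} [IsFiniteMeasure μ] [IsFiniteMeasure ν]
    (h : ∀ L : StrongDual ℝ E,
      ∫ x, Complex.exp (L x * Complex.I) ∂μ = ∫ x, Complex.exp (L x * Complex.I) ∂ν) :
    μ = ν := by
  classical
  -- All functionals together map `E` into a power of `ℝ`, where finite-dimensional marginals
  -- determine a finite measure. A linear form in finitely many of these coordinates is again a
  -- continuous functional on `E`.
  let e : E → StrongDual ℝ E → ℝ := fun x L => L x
  have he : Measurable e := measurable_pi_lambda _ fun L => measurable_dual hE L
  have hproj : ∀ I : Finset (StrongDual ℝ E),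
      (μ.map e).map I.restrict = (ν.map e).map I.restrict := by
    intro I
    rw [Measure.map_map (by fun_prop) he, Measure.map_map (by fun_prop) he]
    have hm : Measurable (I.restrict ∘ e) := by fun_prop
    refine Measure.ext_of_charFunDual (funext fun Λ => ?_)
    rw [charFunDual_apply, charFunDual_apply, integral_map hm.aemeasurable (by fun_prop),
      integral_map hm.aemeasurable (by fun_prop)]
    have key : ∀ x, Λ ((I.restrict ∘ e) x) =
        (∑ i : I, Λ (fun j => if i = j then 1 else 0) • (i : StrongDual ℝ E)) x := by
      intro x
      refine (LinearMap.pi_apply_eq_sum_univ (Λ : (I → ℝ) →ₗ[ℝ] ℝ) _).trans ?_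
      simp [e, mul_comm]
    simp_rw [key]
    exact h _
  have hμν : μ.map e = ν.map e :=
    IsProjectiveLimit.unique (P := fun I => (ν.map e).map I.restrict) hproj fun _ => rfl
  ext s hs
  -- The σ-algebra is pulled back along `e`, so equality of the images suffices and `e` need not be
  -- injective.
  have hcomap : mE = MeasurableSpace.comap e inferInstance := by
    rw [MeasurableSpace.pi, MeasurableSpace.comap_iSup]
    conv_lhs => rw [hE]
    refine iSup_congr fun L => ?_
    rw [MeasurableSpace.comap_comp, BorelSpace.measurable_eq (α := ℝ)]
    rfl
  have hs' := hs
  rw [hcomap] at hs'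
  obtain ⟨t, ht, rfl⟩ := hs'
  rw [← Measure.map_apply he ht, ← Measure.map_apply he ht, hμν]

end Cylinder

/-! ### Gaussian measures and rotation invariance of independence -/

section Gaussian

variable {E : Type*} [AddCommGroup E] [Module ℝ E] [TopologicalSpace E]

theorem memLp_two_dual_of_isGaussian [MeasurableSpace E] (μ : Measure E) [IsGaussian μ]
    {L : StrongDual ℝ E} (hL : Measurable L) : MemLp L 2 μ := by
  suffices MemLp (id ∘ L) 2 μ from this
  rw [← memLp_map_measure_iff (by fun_prop) hL.aemeasurable, IsGaussian.map_eq_gaussianReal L]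
  exact memLp_id_gaussianReal 2

theorem integral_exp_dual_of_isGaussian [MeasurableSpace E] (μ : Measure E) [IsGaussian μ]
    {L : StrongDual ℝ E} (hL : Measurable L) :
    ∫ x, Complex.exp (L x * Complex.I) ∂μ =
      Complex.exp ((∫ x, L x ∂μ : ℝ) * Complex.I - Var[L; μ] / 2) := by
  have h := charFun_map_dual μ hL 1
  rw [IsGaussian.map_eq_gaussianReal, charFun_gaussianReal,
    Real.coe_toNNReal _ (variance_nonneg _ _)] at h
  simpa using h.symm

variable [mE : MeasurableSpace E] [MeasurableAdd₂ E] [MeasurableSub₂ E] [MeasurableConstSMul ℝ E]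

/-- For a Gaussian measure `μ`, the sum and the difference of two independent `μ`-distributed
vectors are independent. -/
theorem map_addSub_of_isGaussian [IsTopologicalAddGroup E] [ContinuousConstSMul ℝ E]
    (hE : mE = cylinderSigmaAlgebra E) (μ : Measure E) [IsGaussian μ] :
    (μ.prod μ).map (addSub E) = ((μ.prod μ).map fun p => p.1 + p.2).prod
      ((μ.prod μ).map fun p => p.1 - p.2) := by
  have hadd : Measurable fun p : E × E => p.1 + p.2 := by fun_prop
  have hsub : Measurable fun p : E × E => p.1 - p.2 := by fun_prop
  have : IsFiniteMeasure ((μ.prod μ).map (addSub E)) := inferInstance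
  have : IsFiniteMeasure ((μ.prod μ).map fun p : E × E => p.1 + p.2) := inferInstance
  have : IsFiniteMeasure ((μ.prod μ).map fun p : E × E => p.1 - p.2) := inferInstance
  refine ext_of_integral_exp_dual (prod_eq_cylinderSigmaAlgebra hE hE) fun L => ?_
  set L₁ := L.comp (.inl ℝ E E) with hL₁
  set L₂ := L.comp (.inr ℝ E E) with hL₂
  have hL (p : E × E) : L p = L₁ p.1 + L₂ p.2 := by simp [hL₁, hL₂, ← map_add]
  have hm₁ := measurable_dual hE L₁
  have hm₂ := measurable_dual hE L₂
  have hp := measurable_dual hE (L₁ + L₂)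
  have hn := measurable_dual hE (L₁ - L₂)
  have hn₂ := measurable_dual hE (-L₂)
  have hmL : Measurable L := measurable_dual (prod_eq_cylinderSigmaAlgebra hE hE) L
  have e1 : ∫ x, Complex.exp (L x * Complex.I) ∂(μ.prod μ).map (addSub E) =
      (∫ x, Complex.exp ((L₁ + L₂) x * Complex.I) ∂μ) *
        ∫ x, Complex.exp ((L₁ - L₂) x * Complex.I) ∂μ := by
    rw [integral_map (addSub E).measurable.aemeasurable (by fun_prop), ← integral_prod_mul]
    refine integral_congr_ae (.of_forall fun p => ?_)
    simp only [hL, addSub_apply, ← Complex.exp_add]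
    congr 1
    simp
    ring
  have e2 : ∫ x, Complex.exp (L₁ x * Complex.I) ∂(μ.prod μ).map (fun p => p.1 + p.2) =
      (∫ x, Complex.exp (L₁ x * Complex.I) ∂μ) * ∫ x, Complex.exp (L₁ x * Complex.I) ∂μ := by
    rw [integral_map hadd.aemeasurable (by fun_prop), ← integral_prod_mul]
    refine integral_congr_ae (.of_forall fun p => ?_)
    simp only [← Complex.exp_add]
    congr 1
    simp
    ring
  have e3 : ∫ x, Complex.exp (L₂ x * Complex.I) ∂(μ.prod μ).map (fun p => p.1 - p.2) =
      (∫ x, Complex.exp (L₂ x * Complex.I) ∂μ) * ∫ x, Complex.exp ((-L₂) x * Complex.I) ∂μ := by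
    rw [integral_map hsub.aemeasurable (by fun_prop), ← integral_prod_mul]
    refine integral_congr_ae (.of_forall fun p => ?_)
    simp only [← Complex.exp_add]
    congr 1
    simp
    ring
  have e4 : ∫ x, Complex.exp (L x * Complex.I) ∂((μ.prod μ).map fun p => p.1 + p.2).prod
      ((μ.prod μ).map fun p => p.1 - p.2) =
      (∫ x, Complex.exp (L₁ x * Complex.I) ∂(μ.prod μ).map (fun p => p.1 + p.2)) *
      ∫ x, Complex.exp (L₂ x * Complex.I) ∂(μ.prod μ).map (fun p => p.1 - p.2) := by
    rw [← integral_prod_mul]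
    refine integral_congr_ae (.of_forall fun p => ?_)
    simp only [hL, ← Complex.exp_add]
    congr 1
    simp
    ring
  have l₁ := memLp_two_dual_of_isGaussian μ hm₁
  have l₂ := memLp_two_dual_of_isGaussian μ hm₂
  have i₁ := l₁.integrable one_le_two
  have i₂ := l₂.integrable one_le_two
  have m1 : μ[(L₁ + L₂ : StrongDual ℝ E)] = μ[L₁] + μ[L₂] := integral_add i₁ i₂
  have m2 : μ[(L₁ - L₂ : StrongDual ℝ E)] = μ[L₁] - μ[L₂] := integral_sub i₁ i₂
  have m3 : μ[(-L₂ : StrongDual ℝ E)] = - μ[L₂] := integral_neg _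
  -- The covariances of `L₁` and `L₂` enter `v1` and `v2` with opposite signs and cancel in the
  -- product of the characteristic functionals.
  have v1 : Var[(L₁ + L₂ : StrongDual ℝ E); μ] = Var[L₁; μ] + 2 * cov[L₁, L₂; μ] + Var[L₂; μ] :=
    variance_add l₁ l₂
  have v2 : Var[(L₁ - L₂ : StrongDual ℝ E); μ] = Var[L₁; μ] - 2 * cov[L₁, L₂; μ] + Var[L₂; μ] :=
    variance_sub l₁ l₂
  have v3 : Var[(-L₂ : StrongDual ℝ E); μ] = Var[L₂; μ] := variance_neg
  rw [e1, e4, e2, e3]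
  simp only [integral_exp_dual_of_isGaussian μ hp, integral_exp_dual_of_isGaussian μ hn,
    integral_exp_dual_of_isGaussian μ hm₁, integral_exp_dual_of_isGaussian μ hm₂,
    integral_exp_dual_of_isGaussian μ hn₂, m1, m2, m3, v1, v2, v3, ← Complex.exp_add]
  congr 1
  push_cast
  ring

/-- If the sum and the difference of two independent `G`-distributed vectors are independent, then
`G` is Gaussian. -/
theorem isGaussian_of_map_addSub (hE : mE = cylinderSigmaAlgebra E) (G : Measure E)
    [IsProbabilityMeasure G] (P Q : Measure E) [SFinite P] [SFinite Q]
    (h : (G.prod G).map (addSub E) = P.prod Q) : IsGaussian G := by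
  refine ⟨fun L => ?_⟩
  have hL := measurable_dual hE L
  have : IsProbabilityMeasure (G.map L) := Measure.isProbabilityMeasure_map hL.aemeasurable
  -- This rests on `(s + t) L x + (s - t) L y = s L (x + y) + t L (x - y)`.
  have key (s t : ℝ) : charFun (G.map L) (s + t) * charFun (G.map L) (s - t) =
      (∫ x, Complex.exp (s * L x * Complex.I) ∂P) * ∫ x, Complex.exp (t * L x * Complex.I) ∂Q := by
    rw [charFun_map_dual G hL, charFun_map_dual G hL, ← integral_prod_mul, ← integral_prod_mul,
      ← h, integral_map (addSub E).measurable.aemeasurable (by fun_prop)]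
    refine integral_congr_ae (.of_forall fun p => ?_)
    simp only [addSub_apply, ← Complex.exp_add]
    congr 1
    simp
    ring
  obtain ⟨m, v, hmv⟩ := exists_eq_gaussianReal_of_charFun (G.map L) fun s t => by
    -- `P` and `Q` need not be normalized; `k0` says that their total masses multiply to 1, which
    -- makes up for it.
    have k0 := key 0 0
    have k1 := key s 0
    have k2 := key 0 t
    rw [key]
    simp only [add_zero, sub_zero, charFun_zero, zero_add, zero_sub, probReal_univ] at k0 k1 k2
    rw [Complex.ofReal_one, one_mul] at k0
    rw [pow_two, k1, k2]
    linear_combination ((∫ x, Complex.exp (s * L x * Complex.I) ∂P) *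
      ∫ x, Complex.exp (t * L x * Complex.I) ∂Q) * k0
  have e1 : G[L] = m := by
    have := integral_map (μ := G) hL.aemeasurable (f := id) (by fun_prop)
    rw [hmv] at this
    simpa using this.symm
  have e2 : Var[L; G] = v := by
    have := variance_map (μ := G) (X := id) (Y := L) (by fun_prop) hL.aemeasurable
    rw [hmv] at this
    simpa using this.symm
  rw [e1, e2, hmv, Real.toNNReal_coe]

end Gaussian

/-! ### Regrouping products and the composed density -/

/-- Needed because rotating `X × X` pairs the points as `((x, z), (x', z'))`, while rotating each
coordinate separately pairs them as `((x, x'), (z, z'))`. -/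
theorem measurePreserving_prodProdProdComm {A B C D : Type*} [MeasurableSpace A]
    [MeasurableSpace B] [MeasurableSpace C] [MeasurableSpace D] (μ : Measure A) (ν : Measure B)
    (ρ : Measure C) (σ : Measure D) [SFinite μ] [SFinite ν] [SFinite ρ] [SFinite σ] :
    MeasurePreserving (Equiv.prodProdProdComm A B C D) ((μ.prod ν).prod (ρ.prod σ))
      ((μ.prod ρ).prod (ν.prod σ)) := by
  have hm : Measurable (Equiv.prodProdProdComm A B C D) := by
    change Measurable fun w : (A × B) × C × D => ((w.1.1, w.2.1), (w.1.2, w.2.2))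
    fun_prop
  refine ⟨hm, Measure.ext_of_lintegral _ fun f hf => ?_⟩
  have hfm : Measurable fun w => f (Equiv.prodProdProdComm A B C D w) := hf.comp hm
  rw [lintegral_map hf hm, lintegral_prod _ hfm.aemeasurable, lintegral_prod _ hf.aemeasurable]
  have h1 : Measurable fun p : A × B => ∫⁻ q, f (Equiv.prodProdProdComm A B C D (p, q)) ∂ρ.prod σ :=
    hfm.lintegral_prod_right'
  have h2 : Measurable fun p : A × C => ∫⁻ q, f (p, q) ∂ν.prod σ := hf.lintegral_prod_right'
  rw [lintegral_prod _ h1.aemeasurable, lintegral_prod _ h2.aemeasurable]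
  refine lintegral_congr fun a => ?_
  have e1 (b : B) : ∫⁻ q, f (Equiv.prodProdProdComm A B C D ((a, b), q)) ∂ρ.prod σ =
      ∫⁻ c, ∫⁻ d, f ((a, c), (b, d)) ∂σ ∂ρ :=
    lintegral_prod (f := fun q : C × D => f ((a, q.1), (b, q.2))) (by fun_prop)
  have e2 (c : C) : ∫⁻ q, f ((a, c), q) ∂ν.prod σ = ∫⁻ b, ∫⁻ d, f ((a, c), (b, d)) ∂σ ∂ν :=
    lintegral_prod (f := fun q : B × D => f ((a, c), q)) (by fun_prop)
  simp_rw [e1, e2]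
  have h3 : Measurable fun w : (B × C) × D => f ((a, w.1.2), (w.1.1, w.2)) := by fun_prop
  exact lintegral_lintegral_swap h3.lintegral_prod_right'.aemeasurable

theorem map_withDensity_comp {A B : Type*} [MeasurableSpace A] [MeasurableSpace B]
    (μ : Measure A) {T : A → B} (hT : Measurable T) {f : B → ℝ≥0∞} (hf : Measurable f) :
    (μ.withDensity fun a => f (T a)).map T = (μ.map T).withDensity f := by
  ext s hs
  rw [Measure.map_apply hT hs, withDensity_apply _ (hT hs), withDensity_apply _ hs,
    setLIntegral_map hs hf hT]

section CompDensity

variable {X : Type*} [MeasurableSpace X]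

/-- The density `(x, z) ↦ (∫ f₁(x, y)^{1/2} f₂(y, z)^{1/2} dμ(y))²` of the half-density composition
of the measures with densities `f₁` and `f₂`. -/
noncomputable def compDensity (μ : Measure X) (f₁ f₂ : X × X → ℝ≥0∞) (p : X × X) : ℝ≥0∞ :=
  (∫⁻ y, f₁ (p.1, y) ^ (1 / 2 : ℝ) * f₂ (y, p.2) ^ (1 / 2 : ℝ) ∂μ) ^ 2

theorem measurable_compDensity (μ : Measure X) [SFinite μ] {f₁ f₂ : X × X → ℝ≥0∞}
    (hf₁ : Measurable f₁) (hf₂ : Measurable f₂) : Measurable (compDensity μ f₁ f₂) := by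
  have : Measurable fun w : (X × X) × X =>
      f₁ (w.1.1, w.2) ^ (1 / 2 : ℝ) * f₂ (w.2, w.1.2) ^ (1 / 2 : ℝ) := by fun_prop
  exact this.lintegral_prod_right'.pow_const 2

end CompDensity

/-! ### Factorization of densities after rotation -/

section Core

variable {X : Type*} [AddCommGroup X] [Module ℝ X] [MeasurableSpace X] [MeasurableAdd₂ X]
  [MeasurableSub₂ X] [MeasurableConstSMul ℝ X]
  {γ α β : Measure X} [SigmaFinite γ] [SigmaFinite β]

/-- The factorization after rotation is inherited by compositions of kernels. -/
theorem factorization_comp (hγ : (γ.prod γ).map (addSub X) = α.prod β)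
    {k₁ k₂ a₁ a₂ b₁ b₂ : X × X → ℝ≥0∞} (hk₁ : Measurable k₁) (hk₂ : Measurable k₂)
    (ha₁ : Measurable a₁) (ha₂ : Measurable a₂) (hb₁ : Measurable b₁) (hb₂ : Measurable b₂)
    (h₁ : ∀ᵐ w ∂((γ.prod γ).prod (γ.prod γ)), k₁ (w.1.1, w.2.1) * k₁ (w.1.2, w.2.2) =
        a₁ (w.1.1 + w.1.2, w.2.1 + w.2.2) * b₁ (w.1.1 - w.1.2, w.2.1 - w.2.2))
    (h₂ : ∀ᵐ w ∂((γ.prod γ).prod (γ.prod γ)), k₂ (w.1.1, w.2.1) * k₂ (w.1.2, w.2.2) =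
        a₂ (w.1.1 + w.1.2, w.2.1 + w.2.2) * b₂ (w.1.1 - w.1.2, w.2.1 - w.2.2)) :
    ∀ᵐ w ∂((γ.prod γ).prod (γ.prod γ)),
      (∫⁻ y, k₁ (w.1.1, y) * k₂ (y, w.2.1) ∂γ) * (∫⁻ y, k₁ (w.1.2, y) * k₂ (y, w.2.2) ∂γ) =
        (∫⁻ u, a₁ (w.1.1 + w.1.2, u) * a₂ (u, w.2.1 + w.2.2) ∂α) *
          ∫⁻ v, b₁ (w.1.1 - w.1.2, v) * b₂ (v, w.2.1 - w.2.2) ∂β := by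
  -- The intermediate pair is the second argument of `k₁` but the first of `k₂`, hence the swap in
  -- `h₂'`.
  have h₁' := Measure.ae_ae_of_ae_prod h₁
  have h₂' := Measure.ae_ae_of_ae_prod
    ((Measure.measurePreserving_swap (μ := γ.prod γ) (ν := γ.prod γ)).quasiMeasurePreserving.ae h₂)
  have g₁ : ∀ᵐ w ∂((γ.prod γ).prod (γ.prod γ)), ∀ᵐ η ∂(γ.prod γ),
      k₁ (w.1.1, η.1) * k₁ (w.1.2, η.2) =
        a₁ (w.1.1 + w.1.2, η.1 + η.2) * b₁ (w.1.1 - w.1.2, η.1 - η.2) :=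
    Measure.quasiMeasurePreserving_fst.ae h₁'
  have g₂ : ∀ᵐ w ∂((γ.prod γ).prod (γ.prod γ)), ∀ᵐ η ∂(γ.prod γ),
      k₂ (η.1, w.2.1) * k₂ (η.2, w.2.2) =
        a₂ (η.1 + η.2, w.2.1 + w.2.2) * b₂ (η.1 - η.2, w.2.1 - w.2.2) :=
    Measure.quasiMeasurePreserving_snd.ae h₂'
  filter_upwards [g₁, g₂] with w hw₁ hw₂
  rw [← lintegral_prod_mul (by fun_prop) (by fun_prop),
    ← lintegral_prod_mul (by fun_prop) (by fun_prop), ← hγ,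
    lintegral_map (by fun_prop) (addSub X).measurable]
  refine lintegral_congr_ae ?_
  filter_upwards [hw₁, hw₂] with η e₁ e₂
  simp only [addSub_apply]
  rw [mul_mul_mul_comm, e₁, e₂, mul_mul_mul_comm]

variable [SigmaFinite α] [MeasurableAdd₂ (X × X)] [MeasurableSub₂ (X × X)]
  [MeasurableConstSMul ℝ (X × X)]

/-- The rotation of `X × X` is the coordinatewise rotation of `X`, conjugated by regroupings. -/
theorem map_addSub_prod_prod (hγ : (γ.prod γ).map (addSub X) = α.prod β) :
    ((γ.prod γ).prod (γ.prod γ)).map (addSub (X × X)) = (α.prod α).prod (β.prod β) := by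
  have h1 := measurePreserving_prodProdProdComm γ γ γ γ
  have h2 : MeasurePreserving (Prod.map (addSub X) (addSub X)) ((γ.prod γ).prod (γ.prod γ))
      ((α.prod β).prod (α.prod β)) :=
    MeasurePreserving.prod ⟨(addSub X).measurable, hγ⟩ ⟨(addSub X).measurable, hγ⟩
  have h3 := measurePreserving_prodProdProdComm α β α β
  exact ((h3.comp h2).comp h1).map_eq

/-- If a measure with density `f` splits as a product after rotation, then so does `f`. -/
theorem exists_factorization_of_map_addSub (hγ : (γ.prod γ).map (addSub X) = α.prod β)
    {f : X × X → ℝ≥0∞} (hf : Measurable f) (P Q : Measure (X × X)) [IsProbabilityMeasure P]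
    [IsProbabilityMeasure Q]
    (h : (((γ.prod γ).withDensity f).prod ((γ.prod γ).withDensity f)).map (addSub (X × X)) =
      P.prod Q) :
    ∃ p q : X × X → ℝ≥0∞, Measurable p ∧ Measurable q ∧
      ∀ᵐ w ∂((γ.prod γ).prod (γ.prod γ)), f (w.1.1, w.2.1) * f (w.1.2, w.2.2) =
        p (w.1.1 + w.1.2, w.2.1 + w.2.2) * q (w.1.1 - w.1.2, w.2.1 - w.2.2) := by
  have hmap := map_addSub_prod_prod hγ
  have hff : ((γ.prod γ).withDensity f).prod ((γ.prod γ).withDensity f) =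
      ((γ.prod γ).prod (γ.prod γ)).withDensity fun w => f w.1 * f w.2 := prod_withDensity hf hf
  have hac : P.prod Q ≪ (α.prod α).prod (β.prod β) := by
    rw [← h, ← hmap, hff]
    exact (withDensity_absolutelyContinuous _ _).map (addSub (X × X)).measurable
  have hP : P ≪ α.prod α := fun s hs => by
    have : (P.prod Q) (s ×ˢ Set.univ) = 0 := hac (by rw [Measure.prod_prod, hs, zero_mul])
    simpa using this
  have hQ : Q ≪ β.prod β := fun s hs => by
    have : (P.prod Q) (Set.univ ×ˢ s) = 0 := hac (by rw [Measure.prod_prod, hs, mul_zero])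
    simpa using this
  set p := P.rnDeriv (α.prod α)
  set q := Q.rnDeriv (β.prod β)
  have hp : Measurable p := Measure.measurable_rnDeriv _ _
  have hq : Measurable q := Measure.measurable_rnDeriv _ _
  have hpq : Measurable fun w : (X × X) × X × X => p w.1 * q w.2 := by fun_prop
  have hPQ : P.prod Q = ((α.prod α).prod (β.prod β)).withDensity fun w => p w.1 * q w.2 := by
    rw [← prod_withDensity hp hq, Measure.withDensity_rnDeriv_eq _ _ hP,
      Measure.withDensity_rnDeriv_eq _ _ hQ]
  rw [hff, hPQ, ← hmap, ← map_withDensity_comp _ (addSub (X × X)).measurable hpq] at h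
  -- The rotation is invertible, so both measures can be compared before rotating, where equality
  -- means a.e. equality of densities.
  have h' := MeasurableEquiv.map_measurableEquiv_injective _ h
  have hpq' := (withDensity_eq_iff_of_sigmaFinite (by fun_prop)
    (hpq.comp (addSub (X × X)).measurable).aemeasurable).1 h'
  exact ⟨p, q, hp, hq, (measurePreserving_prodProdProdComm γ γ γ γ).quasiMeasurePreserving.ae hpq'⟩

/-- If a density splits as a product after rotation, then so does the measure. -/
theorem map_addSub_of_factorization (hγ : (γ.prod γ).map (addSub X) = α.prod β)
    {f p q : X × X → ℝ≥0∞} (hf : Measurable f) (hp : Measurable p) (hq : Measurable q)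
    (h : ∀ᵐ w ∂((γ.prod γ).prod (γ.prod γ)), f (w.1.1, w.2.1) * f (w.1.2, w.2.2) =
        p (w.1.1 + w.1.2, w.2.1 + w.2.2) * q (w.1.1 - w.1.2, w.2.1 - w.2.2)) :
    (((γ.prod γ).withDensity f).prod ((γ.prod γ).withDensity f)).map (addSub (X × X)) =
      ((α.prod α).withDensity p).prod ((β.prod β).withDensity q) := by
  have hpq : Measurable fun w : (X × X) × X × X => p w.1 * q w.2 := by fun_prop
  rw [prod_withDensity hf hf, prod_withDensity hp hq, ← map_addSub_prod_prod hγ,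
    ← map_withDensity_comp _ (addSub (X × X)).measurable hpq]
  congr 1
  refine withDensity_congr_ae ?_
  exact (measurePreserving_prodProdProdComm γ γ γ γ).quasiMeasurePreserving.ae h

/-- The half-density composition of two measures that split after rotation splits as well. -/
theorem exists_map_addSub_comp (hγ : (γ.prod γ).map (addSub X) = α.prod β)
    {f₁ f₂ : X × X → ℝ≥0∞} (hf₁ : Measurable f₁) (hf₂ : Measurable f₂)
    (P₁ Q₁ P₂ Q₂ : Measure (X × X)) [IsProbabilityMeasure P₁] [IsProbabilityMeasure Q₁]
    [IsProbabilityMeasure P₂] [IsProbabilityMeasure Q₂]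
    (h₁ : (((γ.prod γ).withDensity f₁).prod ((γ.prod γ).withDensity f₁)).map (addSub (X × X)) =
      P₁.prod Q₁)
    (h₂ : (((γ.prod γ).withDensity f₂).prod ((γ.prod γ).withDensity f₂)).map (addSub (X × X)) =
      P₂.prod Q₂) :
    ∃ P Q : Measure (X × X), SFinite P ∧ SFinite Q ∧
      (((γ.prod γ).withDensity (compDensity γ f₁ f₂)).prod
        ((γ.prod γ).withDensity (compDensity γ f₁ f₂))).map (addSub (X × X)) = P.prod Q := by
  obtain ⟨p₁, q₁, hp₁, hq₁, e₁⟩ := exists_factorization_of_map_addSub hγ hf₁ P₁ Q₁ h₁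
  obtain ⟨p₂, q₂, hp₂, hq₂, e₂⟩ := exists_factorization_of_map_addSub hγ hf₂ P₂ Q₂ h₂
  have hr {f p q : X × X → ℝ≥0∞}
      (h : ∀ᵐ w ∂((γ.prod γ).prod (γ.prod γ)), f (w.1.1, w.2.1) * f (w.1.2, w.2.2) =
        p (w.1.1 + w.1.2, w.2.1 + w.2.2) * q (w.1.1 - w.1.2, w.2.1 - w.2.2)) :
      ∀ᵐ w ∂((γ.prod γ).prod (γ.prod γ)),
        f (w.1.1, w.2.1) ^ (1 / 2 : ℝ) * f (w.1.2, w.2.2) ^ (1 / 2 : ℝ) =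
        p (w.1.1 + w.1.2, w.2.1 + w.2.2) ^ (1 / 2 : ℝ) *
          q (w.1.1 - w.1.2, w.2.1 - w.2.2) ^ (1 / 2 : ℝ) := by
    filter_upwards [h] with w hw
    rw [← ENNReal.mul_rpow_of_nonneg _ _ (by norm_num), hw,
      ENNReal.mul_rpow_of_nonneg _ _ (by norm_num)]
  have e₃ := factorization_comp hγ (hf₁.pow_const (1 / 2 : ℝ)) (hf₂.pow_const (1 / 2 : ℝ))
    (hp₁.pow_const _) (hp₂.pow_const _) (hq₁.pow_const _) (hq₂.pow_const _) (hr e₁) (hr e₂)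
  refine ⟨_, _, inferInstance, inferInstance, map_addSub_of_factorization hγ
    (measurable_compDensity γ hf₁ hf₂) (measurable_compDensity α hp₁ hp₂)
    (measurable_compDensity β hq₁ hq₂) ?_⟩
  filter_upwards [e₃] with w hw
  simp only [compDensity, ← mul_pow]
  rw [hw]

end Core

open MeasureClass

/-! ### Finite mass, positivity and change of reference measure -/

section CompDensity

variable {X : Type*} [MeasurableSpace X]

/-- Cauchy–Schwarz in the intermediate variable; integrated, it is submultiplicativity of the
Hilbert–Schmidt norm. -/
theorem compDensity_le (μ : Measure X) {f₁ f₂ : X × X → ℝ≥0∞}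
    (hf₁ : Measurable f₁) (hf₂ : Measurable f₂) (p : X × X) :
    compDensity μ f₁ f₂ p ≤ (∫⁻ y, f₁ (p.1, y) ∂μ) * ∫⁻ y, f₂ (y, p.2) ∂μ := by
  have h := ENNReal.lintegral_mul_le_Lp_mul_Lq μ Real.HolderConjugate.two_two
    (f := fun y => f₁ (p.1, y) ^ (1 / 2 : ℝ)) (g := fun y => f₂ (y, p.2) ^ (1 / 2 : ℝ))
    (by fun_prop) (by fun_prop)
  have hsq (a : ℝ≥0∞) : (a ^ (1 / 2 : ℝ)) ^ (2 : ℝ) = a := by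
    rw [← ENNReal.rpow_mul]; norm_num
  simp only [hsq] at h
  calc compDensity μ f₁ f₂ p
      ≤ ((∫⁻ y, f₁ (p.1, y) ∂μ) ^ (1 / 2 : ℝ) * (∫⁻ y, f₂ (y, p.2) ∂μ) ^ (1 / 2 : ℝ)) ^ 2 := by
        exact pow_le_pow_left' h 2
    _ = _ := by
        rw [mul_pow, ← ENNReal.rpow_two, ← ENNReal.rpow_two, hsq, hsq]

theorem lintegral_compDensity_le (μ : Measure X) [SFinite μ] {f₁ f₂ : X × X → ℝ≥0∞}
    (hf₁ : Measurable f₁) (hf₂ : Measurable f₂) :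
    ∫⁻ p, compDensity μ f₁ f₂ p ∂μ.prod μ ≤ (∫⁻ p, f₁ p ∂μ.prod μ) * ∫⁻ p, f₂ p ∂μ.prod μ := by
  refine (lintegral_mono (compDensity_le μ hf₁ hf₂)).trans_eq ?_
  rw [lintegral_prod _ hf₁.aemeasurable, lintegral_prod_symm' _ hf₂, lintegral_prod_mul
    hf₁.lintegral_prod_right'.aemeasurable hf₂.lintegral_prod_left'.aemeasurable]

/-- By Fubini, this lets a.e. statements about two kernels be used under the integral over the
intermediate variable. -/
theorem ae_section_of_ae_prod {μ : Measure X} [SFinite μ] {r s : X × X → Prop}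
    (hr : ∀ᵐ p ∂μ.prod μ, r p) (hs : ∀ᵐ p ∂μ.prod μ, s p) :
    ∀ᵐ p ∂μ.prod μ, ∀ᵐ y ∂μ, r (p.1, y) ∧ s (y, p.2) := by
  have h₁ := Measure.ae_ae_of_ae_prod hr
  have h₂ := Measure.ae_ae_of_ae_prod
    ((Measure.measurePreserving_swap (μ := μ) (ν := μ)).quasiMeasurePreserving.ae hs)
  filter_upwards [Measure.quasiMeasurePreserving_fst.ae h₁,
    Measure.quasiMeasurePreserving_snd.ae h₂] with p hp₁ hp₂
  filter_upwards [hp₁, hp₂] with y hy₁ hy₂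
  exact ⟨hy₁, hy₂⟩

/-- Links real kernels to `compDensity`. No integrability is needed: where the integral diverges,
both sides take the default value 0. -/
theorem ae_integral_mul_eq (μ : Measure X) [SFinite μ] {f₁ f₂ : X × X → ℝ≥0∞}
    (hf₁ : Measurable f₁) (hf₂ : Measurable f₂) (hf₁' : ∀ᵐ p ∂μ.prod μ, f₁ p < ∞)
    (hf₂' : ∀ᵐ p ∂μ.prod μ, f₂ p < ∞) {K₁ K₂ : X × X → ℝ}
    (hK₁ : K₁ =ᵐ[μ.prod μ] fun p => √(f₁ p).toReal)
    (hK₂ : K₂ =ᵐ[μ.prod μ] fun p => √(f₂ p).toReal) :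
    ∀ᵐ p ∂μ.prod μ, ∫ y, K₁ (p.1, y) * K₂ (y, p.2) ∂μ =
      (∫⁻ y, f₁ (p.1, y) ^ (1 / 2 : ℝ) * f₂ (y, p.2) ^ (1 / 2 : ℝ) ∂μ).toReal := by
  filter_upwards [ae_section_of_ae_prod hf₁' hf₂', ae_section_of_ae_prod hK₁ hK₂] with p hp hK
  rw [← integral_toReal (by fun_prop)]
  · refine integral_congr_ae ?_
    filter_upwards [hK] with y hy
    rw [hy.1, hy.2, ENNReal.toReal_mul, ← ENNReal.toReal_rpow, ← ENNReal.toReal_rpow,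
      Real.sqrt_eq_rpow, Real.sqrt_eq_rpow]
  · filter_upwards [hp] with y hy
    exact ENNReal.mul_lt_top (ENNReal.rpow_lt_top_of_nonneg (by norm_num) hy.1.ne)
      (ENNReal.rpow_lt_top_of_nonneg (by norm_num) hy.2.ne)

/-- Makes the composition equivalent to `μ × μ`, not only absolutely continuous. -/
theorem ae_compDensity_ne_zero (μ : Measure X) [SFinite μ] (hμ : μ ≠ 0) {f₁ f₂ : X × X → ℝ≥0∞}
    (hf₁ : Measurable f₁) (hf₂ : Measurable f₂) (hf₁' : ∀ᵐ p ∂μ.prod μ, f₁ p ≠ 0)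
    (hf₂' : ∀ᵐ p ∂μ.prod μ, f₂ p ≠ 0) : ∀ᵐ p ∂μ.prod μ, compDensity μ f₁ f₂ p ≠ 0 := by
  filter_upwards [ae_section_of_ae_prod hf₁' hf₂'] with p hp h0
  rw [compDensity, pow_eq_zero_iff two_ne_zero, lintegral_eq_zero_iff (by fun_prop)] at h0
  have : ∀ᵐ y ∂μ, False := by
    filter_upwards [hp, h0] with y hy hy0
    have h2 : ¬ (2 : ℝ) < 0 := by norm_num
    simp [ENNReal.rpow_eq_zero_iff, hy.1, hy.2, h2] at hy0
  rw [Filter.eventually_false_iff_eq_bot, ae_eq_bot] at this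
  exact hμ this

/-- The half-density composition does not depend on the reference measure. -/
theorem withDensity_compDensity_rnDeriv_eq {μ ρ : Measure X} [SigmaFinite μ] [SigmaFinite ρ]
    (hρμ : ρ ≪ μ) (ν₁ ν₂ : Measure (X × X)) [SigmaFinite ν₁] [SigmaFinite ν₂]
    (h₁ : ν₁ ≪ ρ.prod ρ) (h₂ : ν₂ ≪ ρ.prod ρ) :
    (ρ.prod ρ).withDensity
        (compDensity ρ (ν₁.rnDeriv (ρ.prod ρ)) (ν₂.rnDeriv (ρ.prod ρ))) =
      (μ.prod μ).withDensity
        (compDensity μ (ν₁.rnDeriv (μ.prod μ)) (ν₂.rnDeriv (μ.prod μ))) := by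
  set h := ρ.rnDeriv μ with hh
  have hm : Measurable h := Measure.measurable_rnDeriv _ _
  have hρ : ρ = μ.withDensity h := (Measure.withDensity_rnDeriv_eq _ _ hρμ).symm
  have hprod : ρ.prod ρ = (μ.prod μ).withDensity fun p => h p.1 * h p.2 := by
    conv_lhs => rw [hρ]
    exact prod_withDensity hm hm
  have hd : (ρ.prod ρ).rnDeriv (μ.prod μ) =ᵐ[μ.prod μ] fun p => h p.1 * h p.2 := by
    rw [hprod]
    exact Measure.rnDeriv_withDensity _ (by fun_prop)
  have hchain (ν : Measure (X × X)) [SigmaFinite ν] (hν : ν ≪ ρ.prod ρ) :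
      ν.rnDeriv (μ.prod μ) =ᵐ[μ.prod μ]
        fun p => ν.rnDeriv (ρ.prod ρ) p * (h p.1 * h p.2) := by
    filter_upwards [Measure.rnDeriv_mul_rnDeriv (κ := μ.prod μ) hν, hd] with p hp hp'
    rw [← hp, Pi.mul_apply, hp']
  have m₁ : Measurable (ν₁.rnDeriv (ρ.prod ρ)) := Measure.measurable_rnDeriv _ _
  have m₂ : Measurable (ν₂.rnDeriv (ρ.prod ρ)) := Measure.measurable_rnDeriv _ _
  set F := compDensity ρ (ν₁.rnDeriv (ρ.prod ρ)) (ν₂.rnDeriv (ρ.prod ρ)) with hF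
  have hFm : Measurable F := measurable_compDensity ρ m₁ m₂
  rw [hprod, ← withDensity_mul _ (by fun_prop) hFm]
  refine withDensity_congr_ae ?_
  have hsq (a : ℝ≥0∞) : (a ^ (1 / 2 : ℝ)) ^ 2 = a := by
    rw [← ENNReal.rpow_two, ← ENNReal.rpow_mul]; norm_num
  filter_upwards [ae_section_of_ae_prod (hchain ν₁ h₁) (hchain ν₂ h₂)] with p hp
  -- Each kernel contributes `h y ^ (1 / 2)`, and together they turn `dμ` into `dρ`; the outer
  -- factors become `h p.1 * h p.2` after squaring.
  have key : ∫⁻ y, ν₁.rnDeriv (μ.prod μ) (p.1, y) ^ (1 / 2 : ℝ) *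
        ν₂.rnDeriv (μ.prod μ) (y, p.2) ^ (1 / 2 : ℝ) ∂μ =
      (h p.1 ^ (1 / 2 : ℝ) * h p.2 ^ (1 / 2 : ℝ)) *
      ∫⁻ y, ν₁.rnDeriv (ρ.prod ρ) (p.1, y) ^ (1 / 2 : ℝ) *
        ν₂.rnDeriv (ρ.prod ρ) (y, p.2) ^ (1 / 2 : ℝ) ∂ρ := by
    conv_rhs => rw [hρ]
    rw [lintegral_withDensity_eq_lintegral_mul _ hm (by fun_prop), ← hρ,
      ← lintegral_const_mul _ (by fun_prop)]
    refine lintegral_congr_ae ?_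
    filter_upwards [hp] with y hy
    rw [hy.1, hy.2]
    simp only [Pi.mul_apply]
    conv_rhs => rw [← hsq (h y)]
    simp only [ENNReal.mul_rpow_of_nonneg _ _ (show (0 : ℝ) ≤ 1 / 2 by norm_num)]
    ring
  simp only [Pi.mul_apply, hF, compDensity]
  rw [key, mul_pow, mul_pow, hsq, hsq]

end CompDensity

/-! ### Composition of integral operators -/

section Operators

variable {X : Type*} [MeasurableSpace X]

/-- The composition of two integral operators with `L²` kernels. -/
theorem ae_integral_kernel_comp {μ : Measure X} [SigmaFinite μ] {K₁ K₂ : X × X → ℝ}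
    (hK₁ : MemLp K₁ 2 (μ.prod μ)) (hK₂ : MemLp K₂ 2 (μ.prod μ)) {f : X → ℝ} (hf : MemLp f 2 μ) :
    ∀ᵐ x ∂μ, ∫ y, K₁ (x, y) * ∫ z, K₂ (y, z) * f z ∂μ ∂μ =
      ∫ z, (∫ y, K₁ (x, y) * K₂ (y, z) ∂μ) * f z ∂μ := by
  have hN := memLp_kernel hK₂.norm hf.norm
  filter_upwards [ae_memLp_section hK₁] with x hx
  -- Fubini applies since `K₁ (x, ·)` is in `L²` and so is `y ↦ ∫ |K₂ (y, z) f z| dz`, by `hN`.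
  have hint : Integrable (fun p : X × X => K₁ (x, p.1) * (K₂ p * f p.2)) (μ.prod μ) := by
    refine (integrable_prod_iff (hx.1.comp_fst.mul (hK₂.1.mul hf.1.comp_snd))).2 ⟨?_, ?_⟩
    · filter_upwards [ae_memLp_section hK₂] with y hy
      exact (hy.integrable_mul hf).const_mul (K₁ (x, y))
    · simp only [Pi.mul_apply, norm_mul, integral_const_mul]
      exact hx.norm.integrable_mul hN
  calc ∫ y, K₁ (x, y) * ∫ z, K₂ (y, z) * f z ∂μ ∂μ
      = ∫ y, ∫ z, K₁ (x, y) * (K₂ (y, z) * f z) ∂μ ∂μ := by simp only [integral_const_mul]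
    _ = ∫ z, ∫ y, K₁ (x, y) * (K₂ (y, z) * f z) ∂μ ∂μ := integral_integral_swap hint
    _ = _ := by
      simp only [← mul_assoc, integral_mul_const]

theorem coeFn_coord_sqrtMeasure {𝒞 : MeasureClass X} {ν : Measure X} [IsFiniteMeasure ν]
    (hν : ν ∈ 𝒞) (μ : 𝒞.Rep) : coord (sqrtMeasure ν hν) μ =ᵐ[μ.1] sqrtDeriv ν μ.1 :=
  (memLp_sqrtDeriv ν μ.1).coeFn_toLp

theorem kernelOp_comp_eq {𝒞 : MeasureClass X} (K₁ K₂ K₃ : HalfDensity (𝒞.tensor 𝒞))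
    (h : ∀ μ : 𝒞.Rep, ∀ᵐ p ∂(μ.1.prod μ.1), coord K₃ (μ.prod μ) p =
      ∫ y, coord K₁ (μ.prod μ) (p.1, y) * coord K₂ (μ.prod μ) (y, p.2) ∂μ.1) :
    kernelOp K₁ ∘ₗ kernelOp K₂ = kernelOp K₃ := by
  refine LinearMap.ext fun δ => Subtype.ext (funext fun μ => Lp.ext ?_)
  change kernelCoord K₁ (kernelOp K₂ δ) μ =ᵐ[μ.1] kernelCoord K₃ δ μ
  filter_upwards [coeFn_kernelCoord K₁ (kernelOp K₂ δ) μ, coeFn_kernelCoord K₃ δ μ,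
    Measure.ae_ae_of_ae_prod (h μ), ae_integral_kernel_comp (μ := μ.1)
      (Lp.memLp (coord K₁ (μ.prod μ))) (Lp.memLp (coord K₂ (μ.prod μ)))
      (Lp.memLp (coord δ μ))] with x h1 h2 h3 h4
  rw [h1, h2]
  refine Eq.trans (integral_congr_ae ?_) (h4.trans (integral_congr_ae ?_))
  · filter_upwards [coeFn_kernelCoord K₂ δ μ] with y hy
    change _ * kernelCoord K₂ δ μ y = _
    rw [hy]
  · filter_upwards [h3] with z hz
    rw [hz]

end Operators

/-! ### Existence and density of the composition -/

section Composition

variable {X : Type*} [MeasurableSpace X] {𝒞 : MeasureClass X} {ν₁ ν₂ : Measure (X × X)}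
  [IsFiniteMeasure ν₁] [IsFiniteMeasure ν₂]

theorem ae_integral_coord_eq (h₁ : ν₁ ∈ 𝒞.tensor 𝒞) (h₂ : ν₂ ∈ 𝒞.tensor 𝒞) (μ : 𝒞.Rep) :
    ∀ᵐ p ∂(μ.1.prod μ.1), ∫ η, coord (sqrtMeasure ν₁ h₁) (μ.prod μ) (p.1, η) *
        coord (sqrtMeasure ν₂ h₂) (μ.prod μ) (η, p.2) ∂μ.1 =
      (∫⁻ y, ν₁.rnDeriv (μ.1.prod μ.1) (p.1, y) ^ (1 / 2 : ℝ) *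
        ν₂.rnDeriv (μ.1.prod μ.1) (y, p.2) ^ (1 / 2 : ℝ) ∂μ.1).toReal :=
  ae_integral_mul_eq μ.1 (Measure.measurable_rnDeriv _ _) (Measure.measurable_rnDeriv _ _)
    (Measure.rnDeriv_lt_top _ _) (Measure.rnDeriv_lt_top _ _)
    (coeFn_coord_sqrtMeasure h₁ (μ.prod μ)) (coeFn_coord_sqrtMeasure h₂ (μ.prod μ))

theorem lintegral_compDensity_rnDeriv_lt_top (μ : Measure X) [SigmaFinite μ] :
    ∫⁻ p, compDensity μ (ν₁.rnDeriv (μ.prod μ)) (ν₂.rnDeriv (μ.prod μ)) p ∂(μ.prod μ) < ∞ :=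
  (lintegral_compDensity_le μ (Measure.measurable_rnDeriv _ _)
    (Measure.measurable_rnDeriv _ _)).trans_lt
    (ENNReal.mul_lt_top (Measure.lintegral_rnDeriv_lt_top _ _)
      (Measure.lintegral_rnDeriv_lt_top _ _))

/-- A half-density composition has the expected density. -/
theorem IsComposition.eq_withDensity (h₁ : ν₁ ∈ 𝒞.tensor 𝒞) (h₂ : ν₂ ∈ 𝒞.tensor 𝒞)
    {ν₃ : Measure (X × X)} (h : IsComposition 𝒞 ν₁ ν₂ h₁ h₂ ν₃) (μ : 𝒞.Rep) :
    ν₃ = (μ.1.prod μ.1).withDensity (compDensity μ.1 (ν₁.rnDeriv (μ.1.prod μ.1))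
      (ν₂.rnDeriv (μ.1.prod μ.1))) := by
  obtain ⟨hfin, h₃, -, hd⟩ := h
  have hac : ν₃ ≪ μ.1.prod μ.1 := ac h₃ (μ.prod μ).2
  rw [← Measure.withDensity_rnDeriv_eq _ _ hac]
  refine withDensity_congr_ae ?_
  filter_upwards [hd μ, ae_integral_coord_eq h₁ h₂ μ, ν₃.rnDeriv_lt_top (μ.1.prod μ.1),
    ae_lt_top (measurable_compDensity μ.1 (Measure.measurable_rnDeriv ν₁ (μ.1.prod μ.1))
      (Measure.measurable_rnDeriv ν₂ (μ.1.prod μ.1)))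
      (lintegral_compDensity_rnDeriv_lt_top μ.1).ne] with p hp hp' hlt hlt'
  rw [hp', ← ENNReal.toReal_pow] at hp
  -- Both densities are finite a.e., so equality of real values lifts to `ℝ≥0∞`.
  exact (ENNReal.toReal_eq_toReal_iff' hlt.ne hlt'.ne).1 hp

/-- Half-density compositions exist. -/
theorem exists_isComposition (γ : 𝒞.Rep) (hγ : γ.1 ≠ 0)
    (h₁ : ν₁ ∈ 𝒞.tensor 𝒞) (h₂ : ν₂ ∈ 𝒞.tensor 𝒞) :
    ∃ ν₃, IsComposition 𝒞 ν₁ ν₂ h₁ h₂ ν₃ := by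
  set d : 𝒞.Rep → X × X → ℝ≥0∞ := fun μ => compDensity μ.1 (ν₁.rnDeriv (μ.1.prod μ.1))
    (ν₂.rnDeriv (μ.1.prod μ.1)) with hd
  have hdm (μ : 𝒞.Rep) : Measurable (d μ) :=
    measurable_compDensity μ.1 (Measure.measurable_rnDeriv _ _) (Measure.measurable_rnDeriv _ _)
  set ν₃ := (γ.1.prod γ.1).withDensity (d γ) with hν₃
  have hfin : IsFiniteMeasure ν₃ :=
    isFiniteMeasure_withDensity (lintegral_compDensity_rnDeriv_lt_top γ.1).ne
  have hpos (ν : Measure (X × X)) [IsFiniteMeasure ν] (h : ν ∈ 𝒞.tensor 𝒞) :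
      ∀ᵐ p ∂γ.1.prod γ.1, ν.rnDeriv (γ.1.prod γ.1) p ≠ 0 := by
    filter_upwards [Measure.rnDeriv_pos' (ac (γ.prod γ).2 h)] with p hp
    exact hp.ne'
  have h₃ : ν₃ ∈ 𝒞.tensor 𝒞 := by
    refine ⟨inferInstance, γ.1, γ.2, γ.1, γ.2, withDensity_absolutelyContinuous _ _, ?_⟩
    exact withDensity_absolutelyContinuous' (hdm γ).aemeasurable
      (ae_compDensity_ne_zero γ.1 hγ (Measure.measurable_rnDeriv _ _)
        (Measure.measurable_rnDeriv _ _) (hpos ν₁ h₁) (hpos ν₂ h₂))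
  have hν (μ : 𝒞.Rep) : ν₃ = (μ.1.prod μ.1).withDensity (d μ) :=
    withDensity_compDensity_rnDeriv_eq (ac γ.2 μ.2) ν₁ ν₂ (ac h₁ (γ.prod γ).2)
      (ac h₂ (γ.prod γ).2)
  have hform (μ : 𝒞.Rep) : ∀ᵐ p ∂(μ.1.prod μ.1), (ν₃.rnDeriv (μ.1.prod μ.1) p).toReal =
        (∫ η, coord (sqrtMeasure ν₁ h₁) (μ.prod μ) (p.1, η) *
          coord (sqrtMeasure ν₂ h₂) (μ.prod μ) (η, p.2) ∂μ.1) ^ 2 := by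
    have hr : ν₃.rnDeriv (μ.1.prod μ.1) =ᵐ[μ.1.prod μ.1] d μ := by
      rw [hν μ]
      exact Measure.rnDeriv_withDensity _ (hdm μ)
    filter_upwards [hr, ae_integral_coord_eq h₁ h₂ μ] with p hp hp'
    rw [hp, hp', ← ENNReal.toReal_pow]
    rfl
  refine ⟨ν₃, hfin, h₃, kernelOp_comp_eq _ _ _ fun μ => ?_, hform⟩
  filter_upwards [coeFn_coord_sqrtMeasure h₃ (μ.prod μ), hform μ,
    ae_integral_coord_eq h₁ h₂ μ] with p hp hp' hp''
  rw [hp]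
  change √(ν₃.rnDeriv (μ.1.prod μ.1) p).toReal = _
  -- The composed kernel is nonnegative, so it is the positive root of its square.
  rw [hp', Real.sqrt_sq (by rw [hp'']; exact ENNReal.toReal_nonneg)]

end Composition

/-! ### Gaussianity of the composition -/

/-- The half-density composition of Gaussian measures is a multiple of a Gaussian measure. -/
theorem IsComposition.exists_eq_smul_isGaussian {X : Type*} [AddCommGroup X] [Module ℝ X]
    [TopologicalSpace X] [IsTopologicalAddGroup X] [ContinuousSMul ℝ X]
    [mX : MeasurableSpace X] (hX : mX = cylinderSigmaAlgebra X) {𝒞 : MeasureClass X}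
    (γ : 𝒞.Rep) [IsGaussian γ.1] {ν₁ ν₂ ν₃ : Measure (X × X)} [IsGaussian ν₁] [IsGaussian ν₂]
    (h₁ : ν₁ ∈ 𝒞.tensor 𝒞) (h₂ : ν₂ ∈ 𝒞.tensor 𝒞) (h : IsComposition 𝒞 ν₁ ν₂ h₁ h₂ ν₃) :
    ∃ (c : ℝ≥0) (G : Measure (X × X)), 0 < c ∧ IsGaussian G ∧ ν₃ = c • G := by
  have hXX := prod_eq_cylinderSigmaAlgebra hX hX
  have := measurableAdd₂_of_cylinder hX
  have := measurableSub₂_of_cylinder hX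
  have := measurableConstSMul_of_cylinder hX
  have := measurableAdd₂_of_cylinder hXX
  have := measurableSub₂_of_cylinder hXX
  have := measurableConstSMul_of_cylinder hXX
  have hsum {E : Type _} [AddCommGroup E] [Module ℝ E] [MeasurableSpace E] [MeasurableAdd₂ E]
      (μ : Measure E) [IsProbabilityMeasure μ] :
      IsProbabilityMeasure ((μ.prod μ).map fun p => p.1 + p.2) :=
    Measure.isProbabilityMeasure_map (by fun_prop)
  have hdiff {E : Type _} [AddCommGroup E] [Module ℝ E] [MeasurableSpace E] [MeasurableSub₂ E]
      (μ : Measure E) [IsProbabilityMeasure μ] :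
      IsProbabilityMeasure ((μ.prod μ).map fun p => p.1 - p.2) :=
    Measure.isProbabilityMeasure_map (by fun_prop)
  have e₁ := map_addSub_of_isGaussian hXX ν₁
  have e₂ := map_addSub_of_isGaussian hXX ν₂
  nth_rw 1 2 [← Measure.withDensity_rnDeriv_eq ν₁ _ (ac h₁ (γ.prod γ).2)] at e₁
  nth_rw 1 2 [← Measure.withDensity_rnDeriv_eq ν₂ _ (ac h₂ (γ.prod γ).2)] at e₂
  obtain ⟨P, Q, hP, hQ, hPQ⟩ := exists_map_addSub_comp (map_addSub_of_isGaussian hX γ.1)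
    (Measure.measurable_rnDeriv _ _) (Measure.measurable_rnDeriv _ _) _ _ _ _ e₁ e₂
  have hν := h.eq_withDensity h₁ h₂ γ
  obtain ⟨hfin, h₃, -⟩ := h
  replace hPQ : (ν₃.prod ν₃).map (addSub (X × X)) = P.prod Q := by
    rw [hν]; exact hPQ
  -- `γ × γ` is a probability measure with the same null sets as `ν₃`.
  have hne : ν₃ Set.univ ≠ 0 := fun h0 => by
    have := ac (γ.prod γ).2 h₃ h0
    simp [Rep.prod] at this
  have hlt : ν₃ Set.univ ≠ ∞ := measure_ne_top _ _
  refine ⟨(ν₃ Set.univ).toNNReal, (ν₃ Set.univ)⁻¹ • ν₃, ENNReal.toNNReal_pos hne hlt, ?_, ?_⟩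
  · have : IsProbabilityMeasure ((ν₃ Set.univ)⁻¹ • ν₃) :=
      ⟨by simp [ENNReal.inv_mul_cancel hne hlt]⟩
    -- Normalizing both copies of `ν₃` gives two scalar factors, one for `P` and one for `Q`.
    refine isGaussian_of_map_addSub hXX _ ((ν₃ Set.univ)⁻¹ • P) ((ν₃ Set.univ)⁻¹ • Q) ?_
    rw [Measure.prod_smul_left, Measure.prod_smul_right, Measure.map_smul, Measure.map_smul, hPQ,
      Measure.prod_smul_left, Measure.prod_smul_right]
  · rw [ENNReal.smul_def, ENNReal.coe_toNNReal hlt, smul_smul, ENNReal.mul_inv_cancel hne hlt,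
      one_smul]

end HalfDensities

theorem propositionA15 {X : Type*} [AddCommGroup X] [Module ℝ X] [TopologicalSpace X]
    [IsTopologicalAddGroup X] [ContinuousSMul ℝ X] [LocallyConvexSpace ℝ X]
    [mX : MeasurableSpace X] [StandardBorelSpace X]
    (hX : mX = HalfDensities.cylinderSigmaAlgebra X)
    (𝒞 : HalfDensities.MeasureClass X)
    (h𝒞 : ∃ γ : MeasureTheory.Measure X, ProbabilityTheory.IsGaussian γ ∧ γ ∈ 𝒞)
    (ν₁ ν₂ : MeasureTheory.Measure (X × X))
    [ProbabilityTheory.IsGaussian ν₁] [ProbabilityTheory.IsGaussian ν₂]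
    (h₁ : ν₁ ∈ 𝒞.tensor 𝒞) (h₂ : ν₂ ∈ 𝒞.tensor 𝒞) :
    (∃ ν₃ : MeasureTheory.Measure (X × X), HalfDensities.IsComposition 𝒞 ν₁ ν₂ h₁ h₂ ν₃) ∧
    ∀ ν₃ : MeasureTheory.Measure (X × X), HalfDensities.IsComposition 𝒞 ν₁ ν₂ h₁ h₂ ν₃ →
      ∃ (c : NNReal) (G : MeasureTheory.Measure (X × X)),
        0 < c ∧ ProbabilityTheory.IsGaussian G ∧ ν₃ = c • G := by
  obtain ⟨γ, hγ, hγ𝒞⟩ := h𝒞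
  exact ⟨HalfDensities.exists_isComposition ⟨γ, hγ𝒞⟩ (IsProbabilityMeasure.ne_zero γ) h₁ h₂,
    fun ν₃ h₃ => h₃.exists_eq_smul_isGaussian hX ⟨γ, hγ𝒞⟩ h₁ h₂⟩
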